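/- Let $n\ge 2$ and let $M$ be the manifold of real symmetric positive definite $n\times n$ matrices $\sigma$ with $\det\sigma=1$, identified with $SL(n,\mathbb R)/SO(n)$ via $g\,SO(n)\mapsto gg^*$ ($g^*$ the transpose), with the Riemannian metric $\langle X,Y\rangle_\sigma=c\,\mathrm{tr}(\sigma^{-1}X\sigma^{-1}Y)$ for a constant $c>0$ ($c=1$ is the metric induced by the DeWitt metric), and let $\Delta_M$ be its Laplace–Beltrami operator. Let $\mathfrak a$ be the space of real diagonal matrices of trace zero, with the inner product $4c\,\mathrm{tr}(HH')$ induced by the metric of $M$ (the curve $t\mapsto e^{tH}(e^{tH})^*$ has velocity $2H$ at $t=0$), let $|\cdot|$ be the dual norm on $\mathfrak a^*$, and let $\rho(H)=\tfrac12\sum_{i<j}(H_i-H_j)$. For $k\in SO(n)$ and $\sigma=gg^*\in M$ with $g\in SL(n,\mathbb R)$ let $A(\sigma,k)\in\mathfrak a$ be given by the Iwasawa decomposition $k^{-1}g=\nu\,e^{A(\sigma,k)}\,\kappa$, where $\nu$ is upper triangular with unit diagonal and $\kappa\in SO(n)$. For $\lambda\in\mathfrak a^*$ and a boundary point $b_0=kN_0$,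 where $N_0$ is the group of diagonal matrices in $SO(n)$, let $$e_{\lambda,b_0}(\sigma)=e^{(i\lambda+\rho)(A(\sigma,k))},\qquad \sigma\in M .$$ Let $\mathcal S_0$ be an $n$-dimensional $C^1$ manifold with a continuous Riemannian metric $\chi$. Metrics are expressed in unimodular charts, i.e. charts in which $\det\chi_{ij}=1$, so that the matrix $\chi(x)=(\chi_{ij}(x))$ belongs to $M$ for each $x$ in the chart. Then $e_{\lambda,b_0}$ is a smooth eigenfunction of $-\Delta_M$ with eigenvalue $|\lambda|^2+|\rho|^2$. Moreover, for every $x\in\mathcal S_0$ and every unimodular chart around $x$, put $g_0=\sqrt{\chi(x)^{-1}}$ (the positive square root) and $$v=e_{\lambda,b_0}\circ[g_0],\qquad [g]\sigma=g\sigma g^* .$$ Then $v$ is a smooth, not identically vanishing function on $M$ with $$-\Delta_M v=(|\lambda|^2+|\rho|^2)\,v\qquad\text{and}\qquad v(\chi(x))=1 .$$ -/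

import Mathlib

open scoped Manifold ContDiff Matrix

noncomputable section

/-! ### The Laplace-Beltrami operator in local coordinates -/

namespace LocalRiem

variable {m : ℕ}

/-- The partial derivative `∂F/∂u^A` of a function of `u = (u^1, …, u^m)`. -/
def pd {𝕜 : Type*} [NormedAddCommGroup 𝕜] [NormedSpace ℝ 𝕜]
    (A : Fin m) (F : (Fin m → ℝ) → 𝕜) (u : Fin m → ℝ) : 𝕜 :=
  fderiv ℝ F u (Pi.single A 1)

/-- The Christoffel symbol `Γ^C_{AB}` of the Levi-Civita connection of the metric `G_{AB}`. -/
def christoffel (G : (Fin m → ℝ) → Matrix (Fin m) (Fin m) ℝ) (C A B : Fin m)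
    (u : Fin m → ℝ) : ℝ :=
  (1 / 2) * ∑ D, (G u)⁻¹ C D *
    (pd A (fun w => G w B D) u + pd B (fun w => G w A D) u - pd D (fun w => G w A B) u)

/-- The Laplace-Beltrami operator of the metric `G_{AB}`: the trace of the covariant Hessian,
`ΔF = G^{AB} (∂_A ∂_B F - Γ^C_{AB} ∂_C F)`. -/
def laplace (G : (Fin m → ℝ) → Matrix (Fin m) (Fin m) ℝ) (F : (Fin m → ℝ) → ℂ)
    (u : Fin m → ℝ) : ℂ :=
  ∑ A, ∑ B, (((G u)⁻¹ A B : ℝ) : ℂ) *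
    (pd A (pd B F) u - ∑ C, ((christoffel G C A B u : ℝ) : ℂ) * pd C F u)

end LocalRiem

/-! ### The space `M` of unimodular positive definite matrices -/

/-- `M`: the real positive definite symmetric `n × n` matrices of determinant one. It is
identified with `SL(n,ℝ)/SO(n)` through `g SO(n) ↦ g gᵀ`. -/
def UniMetric (n : ℕ) : Type :=
  {σ : Matrix (Fin n) (Fin n) ℝ // σ.PosDef ∧ σ.det = 1}

namespace UniMetric

variable {n : ℕ}

/-- `dim M = n(n+1)/2 - 1`. -/
def dim (n : ℕ) : ℕ := n * (n + 1) / 2 - 1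

/-- The coordinate tangent vector `∂ψ/∂u^A` of a parametrization `ψ` of (a part of) `M`. -/
def coordVec (ψ : (Fin (dim n) → ℝ) → UniMetric n) (u : Fin (dim n) → ℝ) (A : Fin (dim n)) :
    Matrix (Fin n) (Fin n) ℝ :=
  Matrix.of fun i j => LocalRiem.pd A (fun w => (ψ w).1 i j) u

/-- `ψ` restricted to the open set `U ⊆ ℝ^{dim M}` is a smooth local parametrization of `M`
(the inverse of a smooth coordinate chart): smooth, injective, and an immersion. -/
structure IsParam (ψ : (Fin (dim n) → ℝ) → UniMetric n) (U : Set (Fin (dim n) → ℝ)) : Prop where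
  isOpen : IsOpen U
  smooth : ∀ i j, ContDiffOn ℝ ∞ (fun w => (ψ w).1 i j) U
  injOn : Set.InjOn ψ U
  immersion : ∀ u ∈ U, LinearIndependent ℝ (coordVec ψ u)

/-- The Riemannian metric of `M` at `σ`, `⟨X, Y⟩_σ = c tr(σ⁻¹ X σ⁻¹ Y)`; `c = 1` is the metric
induced by the DeWitt metric. -/
def metric (c : ℝ) (σ : UniMetric n) (X Y : Matrix (Fin n) (Fin n) ℝ) : ℝ :=
  c * (σ.1⁻¹ * X * σ.1⁻¹ * Y).trace

/-- The components `G_{AB}` of the metric of `M` in the coordinates given by `ψ`. -/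
def coordMetric (c : ℝ) (ψ : (Fin (dim n) → ℝ) → UniMetric n) (u : Fin (dim n) → ℝ) :
    Matrix (Fin (dim n)) (Fin (dim n)) ℝ :=
  Matrix.of fun A B => metric c (ψ u) (coordVec ψ u A) (coordVec ψ u B)

/-- `f : M → ℂ` is smooth: it is so in all local coordinates. -/
def Smooth (f : UniMetric n → ℂ) : Prop :=
  ∀ ψ U, IsParam ψ U → ContDiffOn ℝ ∞ (f ∘ ψ) U

/-- `Δ_M f = h`, where `Δ_M` is the Laplace-Beltrami operator of `(M, ⟨·,·⟩)`: the equation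
holds in all local coordinates. -/
def LaplacianEq (c : ℝ) (f h : UniMetric n → ℂ) : Prop :=
  ∀ ψ U, IsParam ψ U → ∀ u ∈ U, LocalRiem.laplace (coordMetric c ψ) (f ∘ ψ) u = h (ψ u)

/-- `f` is an eigenfunction of `-Δ_M` with eigenvalue `μ`: smooth, not identically zero, and
`-Δ_M f = μ f`, i.e. `Δ_M f = -μ f`. -/
structure IsEigenfunction (c : ℝ) (f : UniMetric n → ℂ) (μ : ℝ) : Prop where
  smooth : Smooth f
  ne_zero : f ≠ 0
  eigen : LaplacianEq c f fun σ => -((μ : ℂ) * f σ)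

/-! ### The action of `SL(n,ℝ)` -/

/-- `[g] σ = g σ g*` for `g ∈ SL(n,ℝ)`, with `g*` the transpose of `g`. -/
def act (g : Matrix.SpecialLinearGroup (Fin n) ℝ) (σ : UniMetric n) : UniMetric n :=
  ⟨g.1 * σ.1 * g.1ᵀ, by
    have hu : IsUnit g.1 := by
      rw [Matrix.isUnit_iff_isUnit_det, g.2]; exact isUnit_one
    have h := σ.2.1.mul_mul_conjTranspose_same (B := g.1)
      (Matrix.vecMul_injective_of_isUnit hu)
    rwa [Matrix.conjTranspose_eq_transpose_of_trivial] at h, by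
    rw [Matrix.det_mul, Matrix.det_mul, Matrix.det_transpose, g.2, σ.2.2]; norm_num⟩

open scoped MatrixOrder in
/-- `√(χ⁻¹)`, the positive square root of the inverse of `χ ∈ M`, as an element of `SL(n,ℝ)`. -/
def sqrtInv (χ : UniMetric n) : Matrix.SpecialLinearGroup (Fin n) ℝ :=
  ⟨CFC.sqrt (χ.1⁻¹), by
    have h : 0 ≤ (CFC.sqrt (χ.1⁻¹)).det := (Matrix.nonneg_iff_posSemidef.mp (CFC.sqrt_nonneg (χ.1⁻¹))).det_nonneg
    have h2 : CFC.sqrt (χ.1⁻¹) * CFC.sqrt (χ.1⁻¹) = χ.1⁻¹ :=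
      CFC.sqrt_mul_sqrt_self _ χ.2.1.inv.posSemidef.nonneg
    have h3 := congrArg Matrix.det h2
    rw [Matrix.det_mul, Matrix.det_nonsing_inv, χ.2.2, Ring.inverse_one] at h3
    nlinarith⟩

/-! ### The Fourier kernel -/

variable (n) in
/-- The Lie algebra `𝔞` of the group of positive diagonal matrices in `SL(n,ℝ)`: the diagonal
matrices of trace zero, given by their diagonals. -/
abbrev Cartan : Submodule ℝ (EuclideanSpace ℝ (Fin n)) where
  carrier := {H | ∑ i, H i = 0}
  zero_mem' := by simp
  add_mem' := by
    intro a b ha hb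
    simp only [Set.mem_ofPred_eq] at ha hb ⊢
    simp [Finset.sum_add_distrib, ha, hb]
  smul_mem' := by
    intro r a ha
    simp only [Set.mem_ofPred_eq] at ha ⊢
    simp [← Finset.mul_sum, ha]

/-- `|l|²` for `l ∈ 𝔞*`, the dual norm of the inner product that the metric of `M` induces on `𝔞`.
The curve `t ↦ exp(tH) (exp(tH))ᵀ` in `M` has the velocity `2H` at the identity matrix, so that
this inner product is `⟨2H, 2H'⟩_I = 4c tr(H H')`, while `‖l‖` is dual to `tr(H H')`. -/
def dualNormSq (c : ℝ) (l : StrongDual ℝ (Cartan n)) : ℝ := ‖l‖ ^ 2 / (4 * c)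

variable (n) in
/-- `ρ = ½ ∑_{i<j} α_{ij} ∈ 𝔞*`, half the sum of the positive roots `α_{ij}(H) = H_i - H_j`, `i < j`
(all of multiplicity one). -/
def rho : StrongDual ℝ (Cartan n) :=
  ((1 / 2 : ℝ) • ∑ i : Fin n, ∑ j ∈ Finset.Ioi i,
    ((EuclideanSpace.proj i : EuclideanSpace ℝ (Fin n) →L[ℝ] ℝ) - EuclideanSpace.proj j)).comp
      (Cartan n).subtypeL

/-- `H = A(gK, kN₀)` in terms of `σ = g gᵀ`, where `N₀` is the centralizer of the diagonal group in
`K = SO(n)`: `k⁻¹ g = ν exp(H) κ` is the Iwasawa decomposition of `k⁻¹ g`, with `ν` upper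
triangular unipotent, `H ∈ 𝔞` and `κ ∈ SO(n)`. -/
def IsHorocycleDist (k : Matrix.specialOrthogonalGroup (Fin n) ℝ) (σ : UniMetric n)
    (H : Cartan n) : Prop :=
  ∃ (g : Matrix.SpecialLinearGroup (Fin n) ℝ) (ν : Matrix (Fin n) (Fin n) ℝ)
    (κ : Matrix.specialOrthogonalGroup (Fin n) ℝ),
    g.1 * g.1ᵀ = σ.1 ∧ ν.BlockTriangular id ∧ (∀ i, ν i i = 1) ∧
      k.1ᵀ * g.1 = ν * Matrix.diagonal (fun i => Real.exp (H.1 i)) * κ.1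

/-- `A(σ, b)` for `b = kN₀ ∈ K/N₀`, the composite distance: the `H ∈ 𝔞` with the above property; it
exists and is unique by the Iwasawa decomposition, and depends on `k` through `kN₀` only. -/
def horocycleDist (k : Matrix.specialOrthogonalGroup (Fin n) ℝ) (σ : UniMetric n) : Cartan n :=
  Classical.epsilon (IsHorocycleDist k σ)

/-- The Fourier kernel `e_{λ,b}(σ) = exp((iλ + ρ)(A(σ, b)))` with `b = kN₀`, `λ ∈ 𝔞*`. -/
def fourierKernel (l : StrongDual ℝ (Cartan n)) (k : Matrix.specialOrthogonalGroup (Fin n) ℝ)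
    (σ : UniMetric n) : ℂ :=
  Complex.exp (Complex.I * ((l (horocycleDist k σ) : ℝ) : ℂ)
    + ((rho n (horocycleDist k σ) : ℝ) : ℂ))

end UniMetric

/-! ### Riemannian metrics in unimodular charts -/

namespace RiemChart

variable {n : ℕ} {S : Type*} [TopologicalSpace S] [ChartedSpace (EuclideanSpace ℝ (Fin n)) S]
  [IsManifold (𝓡 n) 1 S]

/-- The coordinate vector field `∂/∂y^i` of the chart `φ`, at the point with coordinates `y`. -/
def coordField (φ : OpenPartialHomeomorph S (EuclideanSpace ℝ (Fin n)))
    (y : EuclideanSpace ℝ (Fin n)) (i : Fin n) : TangentSpace (𝓡 n) (φ.symm y) :=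
  mfderiv (𝓡 n) (𝓡 n) φ.symm y (EuclideanSpace.single i (1 : ℝ) : EuclideanSpace ℝ (Fin n))

/-- The matrix `χ_{ij}` of the Riemannian metric `χ` in the chart `φ`, at the point with
coordinates `y`. -/
def chartMatrix
    (χ : Bundle.ContinuousRiemannianMetric (EuclideanSpace ℝ (Fin n))
      (fun x : S => TangentSpace (𝓡 n) x))
    (φ : OpenPartialHomeomorph S (EuclideanSpace ℝ (Fin n))) (y : EuclideanSpace ℝ (Fin n)) :
    Matrix (Fin n) (Fin n) ℝ :=
  Matrix.of fun i j => χ.inner (φ.symm y) (coordField φ y i) (coordField φ y j)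

/-- The chart `φ` is unimodular for `χ`: `det χ_{ij} = 1` throughout the chart. -/
def IsUnimodular
    (χ : Bundle.ContinuousRiemannianMetric (EuclideanSpace ℝ (Fin n))
      (fun x : S => TangentSpace (𝓡 n) x))
    (φ : OpenPartialHomeomorph S (EuclideanSpace ℝ (Fin n))) : Prop :=
  ∀ x ∈ φ.source, (chartMatrix χ φ (φ x)).det = 1

theorem chartMatrix_posSemidef
    (χ : Bundle.ContinuousRiemannianMetric (EuclideanSpace ℝ (Fin n))
      (fun x : S => TangentSpace (𝓡 n) x))
    (φ : OpenPartialHomeomorph S (EuclideanSpace ℝ (Fin n))) (y : EuclideanSpace ℝ (Fin n)) :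
    (chartMatrix χ φ y).PosSemidef := by
  refine Matrix.PosSemidef.of_dotProduct_mulVec_nonneg ?_ ?_
  · ext i j
    simp [chartMatrix, χ.symm _ (coordField φ y i) (coordField φ y j)]
  · intro v
    have key : star v ⬝ᵥ (chartMatrix χ φ y) *ᵥ v =
        χ.inner (φ.symm y) (∑ i, v i • coordField φ y i) (∑ i, v i • coordField φ y i) := by
      simp only [dotProduct, Matrix.mulVec, chartMatrix, Matrix.of_apply, map_sum, map_smul,
        _root_.sum_apply, _root_.smul_apply, smul_eq_mul,
        star_trivial, Finset.mul_sum]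
      rw [Finset.sum_comm]
      refine Finset.sum_congr rfl fun j _ => Finset.sum_congr rfl fun i _ => ?_
      ring
    rw [key]
    by_cases h : (∑ i, v i • coordField φ y i) = 0
    · rw [h]; simp
    · exact (χ.pos _ _ h).le

/-- `χ(x) ∈ M`: the matrix of `χ` at the point `x` in the unimodular chart `φ` around `x`. -/
def metricAt
    (χ : Bundle.ContinuousRiemannianMetric (EuclideanSpace ℝ (Fin n))
      (fun x : S => TangentSpace (𝓡 n) x))
    (φ : OpenPartialHomeomorph S (EuclideanSpace ℝ (Fin n))) (hφ : IsUnimodular χ φ)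
    (x : S) (hx : x ∈ φ.source) : UniMetric n :=
  ⟨chartMatrix χ φ (φ x), by
    have h := chartMatrix_posSemidef χ φ (φ x)
    rw [h.posDef_iff_isUnit, Matrix.isUnit_iff_isUnit_det, hφ x hx]
    exact isUnit_one, hφ x hx⟩

end RiemChart

end

/-! The proof replaces the Iwasawa decomposition by minors. If `kᵀσk = hhᵀ` with `h` upper
triangular and positive diagonal, the `i`-th entry of `A(σ,k)` is `log h_ii`, which is half the
logarithm of the quotient of two consecutive lower right minors of `kᵀσk` (`logMinor_eq`,
`horocycleDist_apply`). Hence the kernel is `exp(∑ a_i φ_i)` with `φ_i(σ) = logMinor i (kᵀσk)`, `a_i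
= iλ_i + ρ_i`, `ρ_i = (n-1)/2 - i` for `i` counted from zero, and `∑ a_i = 0`.

These functions are eigenfunctions for every invertible `k`, orthogonal or not. As `[g]` merely
replaces `k` by `gᵀk`, the function `v` is covered by the same computation, and the invariance of
the Laplacian is never invoked.

In arbitrary local coordinates, write `σ = ggᵀ` with `g = (kᵀ)⁻¹h` and pull the tangent vectors back
to `Y_A = g⁻¹ ∂_Aσ g⁻ᵀ`. In this frame the differential of `φ_i` is half the `i`-th diagonal entry
of `Y_A`, and its covariant Hessian is an explicit quadratic expression in `Y_A`, `Y_B`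
(`exists_adapted_frame`). The `Y_A` form a basis of the traceless symmetric matrices, so sums
against the inverse Gram matrix follow from a completeness relation (`frame_completeness`). They
give `⟨∇φ_i,∇φ_j⟩ = (δ_ij - 1/n)/(4c)` and `Δφ_i = -ρ_i/(2c)`, so the eigenvalue of `Δ_M` is `∑(a_i²
- 2a_iρ_i)/(4c) = -(|λ|² + |ρ|²)`. Finally `[g₀]χ(x) = 1`, where all minors are `1`, so `v(χ(x)) =
1`. -/

noncomputable section

namespace UniMetric

/-! ### Frames of the traceless symmetric matrices. -/

section Frame

variable {n m : ℕ}

variable (n) in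
/-- The symmetric matrices. -/
def symMatrices : Submodule ℝ (Matrix (Fin n) (Fin n) ℝ) where
  carrier := {X | Xᵀ = X}
  zero_mem' := by simp
  add_mem' := by
    intro a b (ha : aᵀ = a) (hb : bᵀ = b)
    simp [ha, hb]
  smul_mem' := by
    intro r a (ha : aᵀ = a)
    simp [ha]

variable (n) in
/-- The traceless symmetric matrices. -/
def tracelessSym : Submodule ℝ (Matrix (Fin n) (Fin n) ℝ) where
  carrier := {X | Xᵀ = X ∧ X.trace = 0}
  zero_mem' := by simp
  add_mem' := by
    rintro a b ⟨ha, ha'⟩ ⟨hb, hb'⟩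
    simp [ha, hb, ha', hb']
  smul_mem' := by
    rintro r a ⟨ha, ha'⟩
    simp [ha, ha']

theorem mem_symMatrices {X : Matrix (Fin n) (Fin n) ℝ} : X ∈ symMatrices n ↔ Xᵀ = X := Iff.rfl

/-- A symmetric matrix is a function on unordered pairs of indices, and `Sym2 (Fin n)` has
`n(n+1)/2` elements. -/
theorem finrank_symMatrices_le : Module.finrank ℝ (symMatrices n) ≤ n * (n + 1) / 2 := by
  let f : symMatrices n →ₗ[ℝ] (Sym2 (Fin n) → ℝ) :=
    { toFun := fun X s => Sym2.lift ⟨fun i j => X.1 i j, fun i j => by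
        conv_lhs => rw [← mem_symMatrices.1 X.2]
        rfl⟩ s
      map_add' := by
        intro X Y; ext s; induction s with | _ i j => simp
      map_smul' := by
        intro r X; ext s; induction s with | _ i j => simp }
  have hf : Function.Injective f := by
    intro X Y h
    ext i j
    simpa [f] using congrFun h s(i, j)
  have := LinearMap.finrank_le_finrank_of_injective hf
  rw [Module.finrank_fintype_fun_eq_card, Sym2.card, Fintype.card_fin, Nat.choose_two_right] at this
  simpa [mul_comm] using this

/-- The identity matrix is symmetric with nonzero trace, so one dimension is lost. The upper bound
is all that is needed: it forces `dim n` independent vectors to span. -/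
theorem finrank_tracelessSym_le (hn : 0 < n) : Module.finrank ℝ (tracelessSym n) ≤ dim n := by
  have hlt : tracelessSym n < symMatrices n := by
    refine lt_of_le_of_ne (fun X hX => hX.1) fun h => ?_
    have h1 : (1 : Matrix (Fin n) (Fin n) ℝ) ∈ symMatrices n := Matrix.transpose_one
    rw [← h] at h1
    have := h1.2
    simp at this
    omega
  have h1 := Submodule.finrank_lt_finrank_of_lt hlt
  have h2 := finrank_symMatrices_le (n := n)
  unfold dim
  omega

/-- The Gram matrix of a family of matrices for `c tr(X Y)`. -/
def traceGram (c : ℝ) (Y : Fin m → Matrix (Fin n) (Fin n) ℝ) : Matrix (Fin m) (Fin m) ℝ :=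
  Matrix.of fun A B => c * (Y A * Y B).trace

theorem span_eq_tracelessSym (hn : 0 < n) {Y : Fin (dim n) → Matrix (Fin n) (Fin n) ℝ}
    (hY : LinearIndependent ℝ Y) (hmem : ∀ A, Y A ∈ tracelessSym n) :
    Submodule.span ℝ (Set.range Y) = tracelessSym n := by
  refine Submodule.eq_of_le_of_finrank_le (Submodule.span_le.2 ?_) ?_
  · rintro _ ⟨A, rfl⟩; exact hmem A
  · rw [finrank_span_eq_card hY, Fintype.card_fin]
    exact finrank_tracelessSym_le hn

theorem trace_mul_self_eq_zero {Z : Matrix (Fin n) (Fin n) ℝ} (hZ : Zᵀ = Z)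
    (h : (Z * Z).trace = 0) : Z = 0 := by
  have : (Zᴴ * Z).trace = 0 := by
    rwa [Matrix.conjTranspose_eq_transpose_of_trivial, hZ]
  exact Matrix.trace_conjTranspose_mul_self_eq_zero_iff.1 this

/-- A vector in the kernel gives a combination `Z` of the `Y A` with `tr(Z²) = 0`, and the trace
form is definite on symmetric matrices. -/
theorem isUnit_traceGram {c : ℝ} (hc : 0 < c) {Y : Fin m → Matrix (Fin n) (Fin n) ℝ}
    (hY : LinearIndependent ℝ Y) (hsym : ∀ A, (Y A)ᵀ = Y A) : IsUnit (traceGram c Y) := by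
  rw [← Matrix.mulVec_injective_iff_isUnit]
  refine (injective_iff_map_eq_zero (Matrix.mulVecLin (traceGram c Y))).2 fun x hx => ?_
  have hx' : traceGram c Y *ᵥ x = 0 := hx
  set Z := ∑ A, x A • Y A with hZ
  have hZt : Zᵀ = Z := by simp [hZ, Matrix.transpose_sum, hsym]
  have h0 : (Z * Z).trace = 0 := by
    have h1 : ∀ A, (Y A * Z).trace = 0 := by
      intro A
      have := congrFun hx' A
      simp only [Matrix.mulVec, dotProduct, traceGram, Matrix.of_apply, Pi.zero_apply,
        mul_assoc, ← Finset.mul_sum] at this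
      have h2 := (mul_eq_zero.1 this).resolve_left hc.ne'
      rw [hZ, Finset.mul_sum, Matrix.trace_sum]
      simpa [mul_comm] using h2
    rw [hZ, Finset.sum_mul, Matrix.trace_sum, ← hZ]
    simp [h1]
  exact funext fun A => Fintype.linearIndependent_iff.1 hY x (trace_mul_self_eq_zero hZt h0) A

/-- The expansion of a traceless symmetric matrix in a frame. -/
theorem frame_expansion (hn : 0 < n) {c : ℝ} (hc : 0 < c)
    {Y : Fin (dim n) → Matrix (Fin n) (Fin n) ℝ}
    (hY : LinearIndependent ℝ Y) (hmem : ∀ A, Y A ∈ tracelessSym n)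
    {W : Matrix (Fin n) (Fin n) ℝ} (hW : W ∈ tracelessSym n) :
    ∑ A, (∑ B, (traceGram c Y)⁻¹ A B * (c * (Y B * W).trace)) • Y A = W := by
  rw [← span_eq_tracelessSym hn hY hmem, Submodule.mem_span_range_iff_exists_fun] at hW
  obtain ⟨x, rfl⟩ := hW
  have hG := isUnit_traceGram hc hY fun A => (hmem A).1
  have key : (traceGram c Y)⁻¹ *ᵥ (traceGram c Y *ᵥ x) = x := by
    rw [Matrix.mulVec_mulVec, Matrix.nonsing_inv_mul _ ((Matrix.isUnit_iff_isUnit_det _).1 hG),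
      Matrix.one_mulVec]
  refine Finset.sum_congr rfl fun A _ => ?_
  congr 1
  conv_rhs => rw [← key]
  simp only [Matrix.mulVec, dotProduct, traceGram, Matrix.of_apply]
  refine Finset.sum_congr rfl fun B _ => ?_
  congr 1
  rw [Finset.mul_sum, Matrix.trace_sum, Finset.mul_sum]
  refine Finset.sum_congr rfl fun E _ => ?_
  simp only [Matrix.mul_smul, Matrix.trace_smul, smul_eq_mul]
  ring

/-- The completeness relation of a frame of the traceless symmetric matrices. -/
theorem frame_completeness (hn : 0 < n) {c : ℝ} (hc : 0 < c)
    {Y : Fin (dim n) → Matrix (Fin n) (Fin n) ℝ}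
    (hY : LinearIndependent ℝ Y) (hmem : ∀ A, Y A ∈ tracelessSym n) (a b d e : Fin n) :
    ∑ A, ∑ B, (traceGram c Y)⁻¹ A B * (Y A a b * Y B d e) =
      c⁻¹ * (((if a = d ∧ b = e then 1 else 0) + (if a = e ∧ b = d then 1 else 0)) / 2 -
        (if a = b ∧ d = e then 1 else 0) / n) := by
  have hn' : (n : ℝ) ≠ 0 := by exact_mod_cast hn.ne'
  -- `W` is the orthogonal projection of the elementary matrix at `(d, e)` to the traceless
  -- symmetric matrices, so pairing with it reads off the entry `Y B d e`. The claim is the `(a, b)`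
  -- entry of the frame expansion of `W`.
  set W : Matrix (Fin n) (Fin n) ℝ := (1 / 2 : ℝ) • (Matrix.single d e 1 + Matrix.single e d 1) -
    ((if d = e then 1 else 0) / n : ℝ) • 1 with hWdef
  have hW : W ∈ tracelessSym n := by
    refine ⟨?_, ?_⟩
    · simp [hWdef, add_comm]
    · by_cases h : d = e
      · subst h
        simp [hWdef, hn']; norm_num
      · simp [hWdef, Matrix.trace_single_eq_of_ne, h, Ne.symm h]
  have htr : ∀ B, (Y B * W).trace = Y B d e := by
    intro B
    have h1 : Y B e d = Y B d e := by
      conv_lhs => rw [← (hmem B).1]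
      rfl
    simp only [hWdef, mul_sub, mul_add, Matrix.mul_smul, Matrix.trace_sub, Matrix.trace_add,
      Matrix.trace_smul, Matrix.trace_mul_single, mul_one, (hmem B).2, smul_eq_mul, mul_zero,
      h1]
    simp
    ring
  have key := congrFun (congrFun (frame_expansion hn hc hY hmem hW) a) b
  simp only [htr, Matrix.sum_apply, Matrix.smul_apply, smul_eq_mul] at key
  have : ∑ A, ∑ B, (traceGram c Y)⁻¹ A B * (Y A a b * Y B d e) = c⁻¹ * W a b := by
    rw [← key, Finset.mul_sum]
    refine Finset.sum_congr rfl fun A _ => ?_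
    rw [Finset.sum_mul, Finset.mul_sum]
    refine Finset.sum_congr rfl fun B _ => ?_
    field_simp
  rw [this]
  congr 1
  simp only [hWdef, Matrix.sub_apply, Matrix.smul_apply, Matrix.add_apply, Matrix.single_apply,
    Matrix.one_apply, smul_eq_mul]
  have e1 : (d = a ∧ e = b) ↔ (a = d ∧ b = e) := by constructor <;> rintro ⟨rfl, rfl⟩ <;> simp
  have e2 : (e = a ∧ d = b) ↔ (a = e ∧ b = d) := by constructor <;> rintro ⟨rfl, rfl⟩ <;> simp
  simp only [e1, e2]
  by_cases h1 : a = b <;> by_cases h2 : d = e <;> simp [h1, h2] <;> ring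

end Frame

/-! ### Upper triangular factorization and lower right minors. -/

section Minors

variable {n : ℕ}

/-- The Cholesky decomposition, with an upper triangular factor. -/
theorem exists_upper_cholesky {τ : Matrix (Fin n) (Fin n) ℝ} (hτ : τ.PosDef) :
    ∃ h : Matrix (Fin n) (Fin n) ℝ, h.BlockTriangular id ∧ (∀ i, 0 < h i i) ∧ h * hᵀ = τ := by
  -- The LDL decomposition has lower triangular factors; reversing the order of the indices makes
  -- them upper triangular.
  have hS : (τ.submatrix OrderDual.ofDual OrderDual.ofDual).PosDef :=
    hτ.submatrix OrderDual.ofDual.injective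
  set U : Matrix (Fin n) (Fin n) ℝ :=
    (LDL.lowerInv hS).submatrix OrderDual.toDual OrderDual.toDual with hU
  set d : Fin n → ℝ := fun i => LDL.diagEntries hS (OrderDual.toDual i) with hd
  have hdiag : Matrix.diagonal d = U * τ * Uᵀ := by
    have h := congrArg (fun X => X.submatrix OrderDual.toDual OrderDual.toDual)
      (LDL.diag_eq_lowerInv_conj hS)
    rw [Matrix.conjTranspose_eq_transpose_of_trivial] at h
    ext i j
    have := congrFun (congrFun h i) j
    simp only [LDL.diag, Matrix.submatrix_apply] at this
    rw [show Matrix.diagonal d i j =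
      Matrix.diagonal (LDL.diagEntries hS) (OrderDual.toDual i) (OrderDual.toDual j) by
        simp [Matrix.diagonal_apply, hd]]
    rw [this]
    rfl
  have hUt : U.BlockTriangular id := fun i j hij =>
    LDL.lowerInv_triangular hS (OrderDual.toDual_lt_toDual.2 hij)
  have hUinv : IsUnit U := by
    have h1 : IsUnit (LDL.lowerInv hS) := isUnit_of_invertible _
    exact (Matrix.isUnit_submatrix_equiv OrderDual.toDual OrderDual.toDual).2 h1
  have hUdet := (Matrix.isUnit_iff_isUnit_det _).1 hUinv
  have hdpos : ∀ i, 0 < d i := by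
    have h := hτ.mul_mul_conjTranspose_same (B := U) (Matrix.vecMul_injective_of_isUnit hUinv)
    rw [Matrix.conjTranspose_eq_transpose_of_trivial, ← hdiag] at h
    exact Matrix.posDef_diagonal_iff.1 h
  let : Invertible U := hUinv.invertible
  set h0 : Matrix (Fin n) (Fin n) ℝ := U⁻¹ * Matrix.diagonal fun i => √(d i) with hh0
  have h0t : h0.BlockTriangular id :=
    (Matrix.blockTriangular_inv_of_blockTriangular hUt).mul (Matrix.blockTriangular_diagonal _)
  have h0eq : h0 * h0ᵀ = τ := by
    have e : (Matrix.diagonal fun i => √(d i)) * (Matrix.diagonal fun i => √(d i)) =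
        U * τ * Uᵀ := by
      rw [Matrix.diagonal_mul_diagonal, ← hdiag]
      congr 1; ext i; exact Real.mul_self_sqrt (hdpos i).le
    have hUtdet : IsUnit (Uᵀ).det := by rwa [Matrix.det_transpose]
    calc h0 * h0ᵀ = U⁻¹ * ((Matrix.diagonal fun i => √(d i)) *
          (Matrix.diagonal fun i => √(d i))) * (Uᵀ)⁻¹ := by
          simp only [hh0, Matrix.transpose_mul, Matrix.diagonal_transpose,
            Matrix.transpose_nonsing_inv, Matrix.mul_assoc]
      _ = (U⁻¹ * U) * τ * (Uᵀ * (Uᵀ)⁻¹) := by rw [e]; simp only [Matrix.mul_assoc]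
      _ = τ := by
          rw [Matrix.nonsing_inv_mul _ hUdet, Matrix.mul_nonsing_inv _ hUtdet, one_mul, mul_one]
  have h0ne : ∀ i, h0 i i ≠ 0 := by
    have : h0.det ≠ 0 := by
      intro h
      have := congrArg Matrix.det h0eq
      rw [Matrix.det_mul, h, zero_mul] at this
      exact hτ.det_pos.ne this
    rw [Matrix.det_of_isUpperTriangular h0t, Finset.prod_ne_zero_iff] at this
    exact fun i => this i (Finset.mem_univ i)
  -- Changing the signs of columns leaves `h0 * h0ᵀ` unchanged and makes the diagonal positive.
  refine ⟨h0 * Matrix.diagonal fun i => (SignType.sign (h0 i i) : ℝ),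
    h0t.mul (Matrix.blockTriangular_diagonal _), fun i => ?_, ?_⟩
  · rw [Matrix.mul_diagonal, self_mul_sign]
    exact abs_pos.2 (h0ne i)
  · rw [Matrix.transpose_mul, Matrix.diagonal_transpose, Matrix.mul_assoc,
      ← Matrix.mul_assoc (Matrix.diagonal _), Matrix.diagonal_mul_diagonal]
    have : (fun i => ((SignType.sign (h0 i i) : SignType) : ℝ) * (SignType.sign (h0 i i) : SignType))
        = fun _ => 1 := by
      ext i
      rcases lt_or_gt_of_ne (h0ne i) with h | h
      · simp [sign_neg h]
      · simp [sign_pos h]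
    rw [this, Matrix.diagonal_one, one_mul, h0eq]

variable (n) in
/-- The projection onto the coordinates `i ≥ j`. -/
def tailProj (j : ℕ) : Matrix (Fin n) (Fin n) ℝ :=
  Matrix.diagonal fun i => if j ≤ i then 1 else 0

/-- The lower right block of `τ` on the coordinates `i ≥ j`, completed by the identity matrix. -/
def tailBlock (j : ℕ) (τ : Matrix (Fin n) (Fin n) ℝ) : Matrix (Fin n) (Fin n) ℝ :=
  tailProj n j * τ * tailProj n j + (1 - tailProj n j)

theorem tailProj_mul_self (j : ℕ) : tailProj n j * tailProj n j = tailProj n j := by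
  simp [tailProj]

theorem tailProj_transpose (j : ℕ) : (tailProj n j)ᵀ = tailProj n j := by
  simp [tailProj]

theorem tailProj_mul_apply (j : ℕ) (X : Matrix (Fin n) (Fin n) ℝ) (a b : Fin n) :
    (tailProj n j * X) a b = if j ≤ a then X a b else 0 := by
  simp [tailProj]

theorem mul_tailProj_apply (j : ℕ) (X : Matrix (Fin n) (Fin n) ℝ) (a b : Fin n) :
    (X * tailProj n j) a b = if j ≤ b then X a b else 0 := by
  simp [tailProj]

theorem tailProj_mul_of_upper {h : Matrix (Fin n) (Fin n) ℝ} (hh : h.BlockTriangular id) (j : ℕ) :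
    tailProj n j * h * tailProj n j = tailProj n j * h := by
  ext a b
  rw [mul_tailProj_apply, tailProj_mul_apply]
  split_ifs with h1 h2
  · rfl
  · rfl
  · refine (hh ?_).symm
    show b < a
    omega
  · rfl

/-- An upper triangular `h` preserves the span of the coordinates below `j`, so passing to the tail
block is passing to the quotient. Only the left factor has to be triangular, which is why the rule
also applies to `h * hᵀ`. -/
theorem tailBlock_mul_tailBlock {h h' : Matrix (Fin n) (Fin n) ℝ} (hh : h.BlockTriangular id)
    (j : ℕ) : tailBlock j h * tailBlock j h' = tailBlock j (h * h') := by
  have hp := tailProj_mul_self (n := n) j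
  have hu := tailProj_mul_of_upper hh j
  unfold tailBlock
  generalize tailProj n j = p at *
  rw [hu]
  have e1 : (1 - p) * (p * h' * p) = 0 := by
    rw [Matrix.mul_assoc, ← Matrix.mul_assoc, sub_mul, hp, one_mul, sub_self, zero_mul]
  have e2 : p * h * (1 - p) = 0 := by rw [mul_sub, mul_one, hu, sub_self]
  have e3 : (1 - p) * (1 - p) = 1 - p := by
    rw [mul_sub, mul_one, sub_mul, hp, one_mul, sub_self, sub_zero]
  rw [add_mul, mul_add, mul_add, e1, e2, e3, add_zero, zero_add]
  congr 1
  calc p * h * (p * h' * p) = (p * h * p) * h' * p := by simp only [Matrix.mul_assoc]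
    _ = p * (h * h') * p := by rw [hu]; simp only [Matrix.mul_assoc]

theorem tailBlock_one (j : ℕ) : tailBlock j (1 : Matrix (Fin n) (Fin n) ℝ) = 1 := by
  simp [tailBlock, tailProj_mul_self]

theorem tailBlock_transpose (j : ℕ) (X : Matrix (Fin n) (Fin n) ℝ) :
    (tailBlock j X)ᵀ = tailBlock j Xᵀ := by
  simp [tailBlock, tailProj_transpose, Matrix.mul_assoc]

theorem isUnit_of_upper {h : Matrix (Fin n) (Fin n) ℝ} (hh : h.BlockTriangular id)
    (hpos : ∀ i, 0 < h i i) : IsUnit h := by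
  rw [Matrix.isUnit_iff_isUnit_det, Matrix.det_of_isUpperTriangular hh]
  exact (Finset.prod_pos fun i _ => hpos i).ne'.isUnit

theorem upper_inv {h : Matrix (Fin n) (Fin n) ℝ} (hh : h.BlockTriangular id)
    (hpos : ∀ i, 0 < h i i) : (h⁻¹).BlockTriangular id := by
  let := (isUnit_of_upper hh hpos).invertible
  exact Matrix.blockTriangular_inv_of_blockTriangular hh

theorem det_tailBlock_of_upper {h : Matrix (Fin n) (Fin n) ℝ} (hh : h.BlockTriangular id)
    (j : ℕ) : (tailBlock j h).det = ∏ i : Fin n, if j ≤ i then h i i else 1 := by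
  have ht : (tailBlock j h).BlockTriangular id :=
    (((Matrix.blockTriangular_diagonal _).mul hh).mul (Matrix.blockTriangular_diagonal _)).add
      (Matrix.blockTriangular_one.sub (Matrix.blockTriangular_diagonal _))
  rw [Matrix.det_of_isUpperTriangular ht]
  refine Finset.prod_congr rfl fun i _ => ?_
  rw [tailBlock, Matrix.add_apply, mul_tailProj_apply, tailProj_mul_apply, Matrix.sub_apply,
    Matrix.one_apply_eq, tailProj, Matrix.diagonal_apply_eq]
  split_ifs <;> simp

theorem det_tailBlock {h : Matrix (Fin n) (Fin n) ℝ} (hh : h.BlockTriangular id) (j : ℕ) :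
    (tailBlock j (h * hᵀ)).det = ∏ i : Fin n, if j ≤ i then h i i ^ 2 else 1 := by
  rw [← tailBlock_mul_tailBlock hh, ← tailBlock_transpose, Matrix.det_mul, Matrix.det_transpose,
    det_tailBlock_of_upper hh, ← Finset.prod_mul_distrib]
  refine Finset.prod_congr rfl fun i _ => ?_
  split_ifs <;> ring

theorem det_tailBlock_pos {τ : Matrix (Fin n) (Fin n) ℝ} (hτ : τ.PosDef) (j : ℕ) :
    0 < (tailBlock j τ).det := by
  obtain ⟨h, hh, hpos, rfl⟩ := exists_upper_cholesky hτ
  rw [det_tailBlock hh]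
  refine Finset.prod_pos fun i _ => ?_
  have := hpos i
  split_ifs <;> positivity

/-- The compression of the inverse of `tailBlock j τ` in terms of the Cholesky factor. -/
theorem tailProj_inv_tailBlock {h : Matrix (Fin n) (Fin n) ℝ} (hh : h.BlockTriangular id)
    (hpos : ∀ i, 0 < h i i) (j : ℕ) :
    hᵀ * (tailProj n j * (tailBlock j (h * hᵀ))⁻¹ * tailProj n j) * h = tailProj n j := by
  have hi := upper_inv hh hpos
  have hdet := (Matrix.isUnit_iff_isUnit_det _).1 (isUnit_of_upper hh hpos)
  have e1 : tailBlock j h⁻¹ * tailBlock j h = 1 := by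
    rw [tailBlock_mul_tailBlock hi, Matrix.nonsing_inv_mul _ hdet, tailBlock_one]
  have e2 : (tailBlock j (h * hᵀ))⁻¹ = (tailBlock j h⁻¹)ᵀ * tailBlock j h⁻¹ := by
    refine Matrix.inv_eq_left_inv ?_
    rw [← tailBlock_mul_tailBlock hh, ← tailBlock_transpose, Matrix.mul_assoc,
      ← Matrix.mul_assoc (tailBlock j h⁻¹), e1, one_mul, ← Matrix.transpose_mul]
    rw [mul_eq_one_comm.1 e1, Matrix.transpose_one]
  have hu := tailProj_mul_of_upper hi j
  have hp := tailProj_mul_self (n := n) j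
  have ht := tailProj_transpose (n := n) j
  have e3 : tailBlock j h⁻¹ * tailProj n j = h⁻¹ * tailProj n j - (1 - tailProj n j) * h⁻¹ * tailProj n j
      := by
    unfold tailBlock
    rw [add_mul, Matrix.mul_assoc _ (tailProj n j) (tailProj n j), hp, sub_mul, one_mul, hp, sub_self,
      add_zero, sub_mul, one_mul, sub_mul]
    abel
  have e4 : tailBlock j h⁻¹ * tailProj n j * h = tailProj n j := by
    have : tailBlock j h⁻¹ * tailProj n j = tailProj n j * h⁻¹ := by
      rw [e3, sub_mul, one_mul, sub_mul, hu]; abel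
    rw [this, Matrix.mul_assoc, Matrix.nonsing_inv_mul _ hdet, mul_one]
  rw [e2]
  calc hᵀ * (tailProj n j * ((tailBlock j h⁻¹)ᵀ * tailBlock j h⁻¹) * tailProj n j) * h
      = (tailBlock j h⁻¹ * tailProj n j * h)ᵀ * (tailBlock j h⁻¹ * tailProj n j * h) := by
        simp only [Matrix.transpose_mul, ht, Matrix.mul_assoc]
    _ = tailProj n j := by rw [e4, ht, hp]

/-- Half the logarithm of the quotient of two consecutive lower right minors. -/
def logMinor (i : ℕ) (τ : Matrix (Fin n) (Fin n) ℝ) : ℝ :=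
  1 / 2 * (Real.log (tailBlock i τ).det - Real.log (tailBlock (i + 1) τ).det)

/-- The `j`-th minor is the product of the `h i i ^ 2` with `i ≥ j`, so the quotient of consecutive
minors leaves a single square. -/
theorem logMinor_eq {h : Matrix (Fin n) (Fin n) ℝ} (hh : h.BlockTriangular id)
    (hpos : ∀ i, 0 < h i i) (i : Fin n) : logMinor i (h * hᵀ) = Real.log (h i i) := by
  have hl : ∀ j : ℕ, Real.log (tailBlock j (h * hᵀ)).det =
      ∑ i : Fin n, if j ≤ i then 2 * Real.log (h i i) else 0 := by
    intro j
    rw [det_tailBlock hh, Real.log_prod]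
    · refine Finset.sum_congr rfl fun i _ => ?_
      split_ifs <;> simp
    · intro i _
      have := (hpos i).ne'
      split_ifs <;> positivity
  rw [logMinor, hl, hl, ← Finset.sum_sub_distrib, Finset.sum_eq_single i]
  · simp
  · intro b _ hb
    have : (b : ℕ) ≠ i := fun h => hb (Fin.ext h)
    by_cases h1 : (i : ℕ) ≤ b
    · rw [if_pos h1, if_pos (by omega), sub_self]
    · rw [if_neg h1, if_neg (by omega), sub_self]
  · simp

end Minors

end UniMetric

/-! ### Calculus of partial derivatives of matrix-valued functions. -/

open scoped Matrix.Norms.Operator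

namespace LocalRiem

section PartialDerivatives

variable {m n : ℕ} {X Z : Type*} [NormedAddCommGroup X] [NormedSpace ℝ X]
  [NormedAddCommGroup Z] [NormedSpace ℝ Z]

theorem pd_congr {A : Fin m} {F F' : (Fin m → ℝ) → X} {u : Fin m → ℝ} (h : F =ᶠ[nhds u] F') :
    pd A F u = pd A F' u := by
  rw [pd, pd, h.fderiv_eq]

theorem pd_clm {A : Fin m} {F : (Fin m → ℝ) → X} {u : Fin m → ℝ} (T : X →L[ℝ] Z)
    (hF : DifferentiableAt ℝ F u) : pd A (fun w => T (F w)) u = T (pd A F u) := by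
  have := (T.hasFDerivAt.comp u hF.hasFDerivAt).fderiv
  unfold pd
  rw [show (fun w => T (F w)) = T ∘ F from rfl, this]
  rfl

theorem pd_mul {R : Type*} [NormedRing R] [NormedAlgebra ℝ R] {A : Fin m} {F G : (Fin m → ℝ) → R}
    {u : Fin m → ℝ} (hF : DifferentiableAt ℝ F u) (hG : DifferentiableAt ℝ G u) :
    pd A (fun w => F w * G w) u = pd A F u * G u + F u * pd A G u := by
  unfold pd
  rw [fderiv_fun_mul' hF hG]
  simp [add_comm]

theorem pd_sum {ι : Type*} (s : Finset ι) {A : Fin m} {F : ι → (Fin m → ℝ) → X}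
    {u : Fin m → ℝ} (hF : ∀ i ∈ s, DifferentiableAt ℝ (F i) u) :
    pd A (fun w => ∑ i ∈ s, F i w) u = ∑ i ∈ s, pd A (F i) u := by
  unfold pd
  rw [fderiv_fun_sum hF]
  simp

theorem pd_sub {A : Fin m} {F G : (Fin m → ℝ) → X}
    {u : Fin m → ℝ} (hF : DifferentiableAt ℝ F u) (hG : DifferentiableAt ℝ G u) :
    pd A (fun w => F w - G w) u = pd A F u - pd A G u := by
  unfold pd
  rw [fderiv_fun_sub hF hG]
  simp

theorem pd_const (A : Fin m) (x : X) (u : Fin m → ℝ) : pd A (fun _ => x) u = 0 := by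
  simp [pd]

theorem pd_sandwich {R : Type*} [NormedRing R] [NormedAlgebra ℝ R] {A : Fin m}
    {F : (Fin m → ℝ) → R} {u : Fin m → ℝ} (a b : R) (hF : DifferentiableAt ℝ F u) :
    pd A (fun w => a * F w * b) u = a * pd A F u * b := by
  rw [pd_mul (hF.const_mul a) (differentiableAt_const b), pd_mul (differentiableAt_const a) hF,
    pd_const, pd_const, zero_mul, zero_add, mul_zero, add_zero]

theorem pd_cexp {A : Fin m} {F : (Fin m → ℝ) → ℂ} {u : Fin m → ℝ} (hF : DifferentiableAt ℝ F u) :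
    pd A (fun w => Complex.exp (F w)) u = Complex.exp (F u) * pd A F u := by
  unfold pd
  rw [(hF.hasFDerivAt.cexp).fderiv]
  simp

theorem contDiffAt_pd {A : Fin m} {F : (Fin m → ℝ) → X} {u : Fin m → ℝ}
    (hF : ContDiffAt ℝ ∞ F u) : ContDiffAt ℝ ∞ (pd A F) u :=
  (hF.fderiv_right (m := ∞) (by simp)).clm_apply contDiffAt_const

theorem pd_comm {A B : Fin m} {F : (Fin m → ℝ) → X} {u : Fin m → ℝ}
    (hF : ContDiffAt ℝ ∞ F u) : pd A (pd B F) u = pd B (pd A F) u := by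
  have hd : DifferentiableAt ℝ (fderiv ℝ F) u :=
    (hF.fderiv_right (m := ∞) (by simp)).differentiableAt (by simp)
  have h : ∀ C D : Fin m, pd C (pd D F) u =
      fderiv ℝ (fderiv ℝ F) u (Pi.single C 1) (Pi.single D 1) := by
    intro C D
    unfold pd
    rw [fderiv_clm_apply hd (by fun_prop)]
    simp
  rw [h, h]
  exact hF.isSymmSndFDerivAt (by simpa using ENat.LEInfty.out) _ _

theorem _root_.Matrix.contDiff_det : ContDiff ℝ ∞ (Matrix.det : Matrix (Fin n) (Fin n) ℝ → ℝ) := by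
  have h : ∀ i j, ContDiff ℝ ∞ fun M : Matrix (Fin n) (Fin n) ℝ => M i j := fun i j =>
    (LinearMap.toContinuousLinearMap (Matrix.entryLinearMap ℝ ℝ i j)).contDiff
  simp only [funext Matrix.det_apply]
  exact ContDiff.sum fun σ _ => (contDiff_prod fun i _ => h _ _).const_smul _

/-- Jacobi's formula: `det(M + tX) = det M · det(1 + tM⁻¹X)` is a polynomial in `t` whose linear
coefficient is known. -/
theorem _root_.Matrix.fderiv_det {M : Matrix (Fin n) (Fin n) ℝ} (hM : IsUnit M.det)
    (X : Matrix (Fin n) (Fin n) ℝ) : fderiv ℝ Matrix.det M X = M.det * (M⁻¹ * X).trace := by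
  have hd : DifferentiableAt ℝ Matrix.det M := Matrix.contDiff_det.contDiffAt.differentiableAt (by simp)
  refine (hd.lineDeriv_eq_fderiv (v := X)).symm.trans ?_
  have hpath : (fun t : ℝ => (M + t • X).det) = fun t =>
      M.det * (Matrix.det (1 + (Polynomial.X : Polynomial ℝ) •
        (M⁻¹ * X).map Polynomial.C)).eval t := by
    funext t
    have : M + t • X = M * (1 + t • (M⁻¹ * X)) := by
      rw [mul_add, mul_one, Matrix.mul_smul, ← Matrix.mul_assoc, Matrix.mul_nonsing_inv _ hM,
        one_mul]
    rw [this, Matrix.det_mul, eval_det]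
    congr 2
    ext i j
    rw [matPolyEquiv_eval]
    generalize M⁻¹ * X = Q
    by_cases h : i = j <;> simp [h, mul_comm t]
  have h := (Polynomial.hasDerivAt (Matrix.det (1 + (Polynomial.X : Polynomial ℝ) •
        (M⁻¹ * X).map Polynomial.C)) 0).const_mul M.det
  rw [Matrix.derivative_det_one_add_X_smul, ← hpath] at h
  exact h.deriv

theorem pd_logdet {A : Fin m} {F : (Fin m → ℝ) → Matrix (Fin n) (Fin n) ℝ} {u : Fin m → ℝ}
    (hF : DifferentiableAt ℝ F u) (hu : (F u).det ≠ 0) :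
    pd A (fun w => Real.log (F w).det) u = ((F u)⁻¹ * pd A F u).trace := by
  have hd : DifferentiableAt ℝ Matrix.det (F u) :=
    Matrix.contDiff_det.contDiffAt.differentiableAt (by simp)
  have h1 := hd.hasFDerivAt.comp u hF.hasFDerivAt
  have h2 := (h1.log hu).fderiv
  unfold pd
  rw [show (fun w => Real.log (F w).det) = fun w => Real.log ((Matrix.det ∘ F) w) from rfl, h2]
  change (F u).det⁻¹ * fderiv ℝ Matrix.det (F u) (fderiv ℝ F u (Pi.single A 1)) = _
  rw [Matrix.fderiv_det hu.isUnit, inv_mul_cancel_left₀ hu]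
  rfl

theorem differentiableAt_inv {F : (Fin m → ℝ) → Matrix (Fin n) (Fin n) ℝ} {u : Fin m → ℝ}
    (hF : DifferentiableAt ℝ F u) (hu : IsUnit (F u)) :
    DifferentiableAt ℝ (fun w => (F w)⁻¹) u := by
  simp only [Matrix.nonsing_inv_eq_ringInverse]
  exact (differentiableAt_inverse hu).comp u hF

theorem pd_inv {A : Fin m} {F : (Fin m → ℝ) → Matrix (Fin n) (Fin n) ℝ} {u : Fin m → ℝ}
    (hF : DifferentiableAt ℝ F u) (hu : IsUnit (F u)) :
    pd A (fun w => (F w)⁻¹) u = -((F u)⁻¹ * pd A F u * (F u)⁻¹) := by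
  obtain ⟨v, hv⟩ := hu
  have h := (hasFDerivAt_ringInverse (𝕜 := ℝ) v)
  rw [hv] at h
  have h2 := (h.comp u hF.hasFDerivAt).fderiv
  unfold pd
  simp only [Matrix.nonsing_inv_eq_ringInverse]
  rw [show (fun w => Ring.inverse (F w)) = Ring.inverse ∘ F from rfl, h2, ← hv, Ring.inverse_unit]
  rfl

/-- The trace as a continuous linear map. -/
def traceL (n : ℕ) : Matrix (Fin n) (Fin n) ℝ →L[ℝ] ℝ :=
  LinearMap.toContinuousLinearMap (Matrix.traceLinearMap (Fin n) ℝ ℝ)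

theorem differentiableAt_trace {F : (Fin m → ℝ) → Matrix (Fin n) (Fin n) ℝ} {u : Fin m → ℝ}
    (hF : DifferentiableAt ℝ F u) : DifferentiableAt ℝ (fun w => (F w).trace) u :=
  (traceL n).differentiableAt.comp u hF

theorem pd_trace {A : Fin m} {F : (Fin m → ℝ) → Matrix (Fin n) (Fin n) ℝ} {u : Fin m → ℝ}
    (hF : DifferentiableAt ℝ F u) : pd A (fun w => (F w).trace) u = (pd A F u).trace :=
  pd_clm (traceL n) hF

theorem pd_entry {A : Fin m} {F : (Fin m → ℝ) → Matrix (Fin n) (Fin n) ℝ} {u : Fin m → ℝ}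
    (hF : DifferentiableAt ℝ F u) (i j : Fin n) : pd A (fun w => F w i j) u = pd A F u i j :=
  pd_clm (LinearMap.toContinuousLinearMap (Matrix.entryLinearMap ℝ ℝ i j)) hF

theorem contDiffAt_matrix {F : (Fin m → ℝ) → Matrix (Fin n) (Fin n) ℝ} {u : Fin m → ℝ}
    (hF : ∀ i j, ContDiffAt ℝ ∞ (fun w => F w i j) u) : ContDiffAt ℝ ∞ F u := by
  have h : F = fun w => ∑ i, ∑ j, F w i j • Matrix.single i j (1 : ℝ) := by
    funext w
    conv_lhs => rw [Matrix.matrix_eq_sum_single (F w)]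
    simp
  rw [h]
  exact ContDiffAt.sum fun i _ => ContDiffAt.sum fun j _ => (hF i j).smul contDiffAt_const

/-- The coordinate metric has its closed form only on the parametrized open set; since Christoffel
symbols contain derivatives, agreement near `u` is what is required. -/
theorem laplace_congr {G G' : (Fin m → ℝ) → Matrix (Fin m) (Fin m) ℝ} {F : (Fin m → ℝ) → ℂ}
    {u : Fin m → ℝ} (hG : G =ᶠ[nhds u] G') : laplace G F u = laplace G' F u := by
  have h : ∀ C A B, christoffel G C A B u = christoffel G' C A B u := by
    intro C A B
    unfold christoffel
    have h1 : ∀ A B D, pd D (fun w => G w A B) u = pd D (fun w => G' w A B) u := fun A B D =>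
      pd_congr (hG.mono fun w hw => by simp only [hw])
    simp only [h1, hG.eq_of_nhds]
  simp only [laplace, h, hG.eq_of_nhds]

end PartialDerivatives

end LocalRiem

namespace UniMetric

open LocalRiem

/-! ### The Levi-Civita connection of the invariant metric. -/

section Connection

variable {m n : ℕ} {S : (Fin m → ℝ) → Matrix (Fin n) (Fin n) ℝ} {u : Fin m → ℝ}

/-- The logarithmic partial derivative `S⁻¹ ∂_A S`. -/
def logPd (S : (Fin m → ℝ) → Matrix (Fin n) (Fin n) ℝ) (A : Fin m) (w : Fin m → ℝ) :
    Matrix (Fin n) (Fin n) ℝ :=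
  (S w)⁻¹ * pd A S w

theorem differentiableAt_pd (hS : ContDiffAt ℝ ∞ S u) (A : Fin m) :
    DifferentiableAt ℝ (pd A S) u :=
  (contDiffAt_pd hS).differentiableAt (by simp)

theorem differentiableAt_logPd (hS : ContDiffAt ℝ ∞ S u) (hu : IsUnit (S u)) (A : Fin m) :
    DifferentiableAt ℝ (logPd S A) u :=
  (differentiableAt_inv (hS.differentiableAt (by simp)) hu).mul (differentiableAt_pd hS A)

theorem pd_logPd (hS : ContDiffAt ℝ ∞ S u) (hu : IsUnit (S u)) (A D : Fin m) :
    pd D (logPd S A) u = (S u)⁻¹ * pd D (pd A S) u - logPd S D u * logPd S A u := by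
  have hd := hS.differentiableAt (by simp)
  have := pd_mul (A := D) (differentiableAt_inv hd hu) (differentiableAt_pd hS A)
  unfold logPd
  rw [this, pd_inv hd hu]
  simp only [neg_mul, Matrix.mul_assoc]
  abel

theorem pd_traceGram_logPd (c : ℝ) (hS : ContDiffAt ℝ ∞ S u) (hu : IsUnit (S u))
    (A B D : Fin m) :
    pd D (fun w => traceGram c (fun E => logPd S E w) A B) u =
      c * (((S u)⁻¹ * pd D (pd A S) u - logPd S D u * logPd S A u) * logPd S B u +
        logPd S A u * ((S u)⁻¹ * pd D (pd B S) u - logPd S D u * logPd S B u)).trace := by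
  have hA := differentiableAt_logPd hS hu A
  have hB := differentiableAt_logPd hS hu B
  rw [← pd_logPd hS hu, ← pd_logPd hS hu, ← pd_mul hA hB, ← pd_trace (hA.fun_mul hB)]
  have hAB := differentiableAt_trace (hA.fun_mul hB)
  exact pd_clm (c • ContinuousLinearMap.id ℝ ℝ) hAB

/-- The Christoffel symbols of the invariant metric. -/
theorem christoffel_traceGram_logPd (c : ℝ) (hS : ContDiffAt ℝ ∞ S u) (hu : IsUnit (S u))
    (C A B : Fin m) :
    christoffel (fun w => traceGram c fun E => logPd S E w) C A B u =
      ∑ D, (traceGram c fun E => logPd S E u)⁻¹ C D *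
        (c * (logPd S D u * ((S u)⁻¹ * pd A (pd B S) u -
          (1 / 2 : ℝ) • (logPd S A u * logPd S B u + logPd S B u * logPd S A u))).trace) := by
  unfold christoffel
  rw [Finset.mul_sum]
  refine Finset.sum_congr rfl fun D _ => ?_
  -- After the second derivatives are commuted, those containing the index `D` cancel and the `A`,
  -- `B` derivative survives twice; cyclicity of the trace leaves only two distinct cubic terms.
  rw [pd_traceGram_logPd c hS hu, pd_traceGram_logPd c hS hu, pd_traceGram_logPd c hS hu,
    pd_comm (A := B) (B := A) hS, pd_comm (A := D) (B := A) hS, pd_comm (A := D) (B := B) hS]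
  generalize logPd S A u = a
  generalize logPd S B u = b
  generalize logPd S D u = d
  generalize (S u)⁻¹ * pd A (pd B S) u = x
  generalize (S u)⁻¹ * pd A (pd D S) u = y
  generalize (S u)⁻¹ * pd B (pd D S) u = z
  have h1 : (d * (a * b)).trace = (a * b * d).trace := Matrix.trace_mul_comm _ _
  have h2 : (d * (b * a)).trace = (b * a * d).trace := Matrix.trace_mul_comm _ _
  have h3 : (b * (a * d)).trace = (a * d * b).trace := Matrix.trace_mul_comm _ _
  have h5 : (b * y).trace = (y * b).trace := Matrix.trace_mul_comm _ _
  have h6 : (a * z).trace = (z * a).trace := Matrix.trace_mul_comm _ _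
  have h7 : (d * x).trace = (x * d).trace := Matrix.trace_mul_comm _ _
  have h9 : (a * d * b).trace = (b * a * d).trace := by
    rw [← h3, Matrix.mul_assoc]
  have h10 : (d * b * a).trace = (b * a * d).trace := by rw [Matrix.mul_assoc, h2]
  have h11 : (d * a * b).trace = (a * b * d).trace := by rw [Matrix.mul_assoc, h1]
  simp only [mul_sub, sub_mul, mul_add, Matrix.mul_smul, Matrix.trace_add, Matrix.trace_sub,
    Matrix.trace_smul, smul_eq_mul, h5, h6, h7, h9, h10, h11,
    (Matrix.mul_assoc _ _ _).symm]
  ring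

end Connection

/-! ### First and second derivatives of the logarithmic minors. -/

section Minors

variable {m n : ℕ} {S : (Fin m → ℝ) → Matrix (Fin n) (Fin n) ℝ} {u : Fin m → ℝ}
  {k : Matrix (Fin n) (Fin n) ℝ}

/-- The gradient of the logarithm of a lower right minor of `kᵀ σ k`. -/
def minorGrad (k : Matrix (Fin n) (Fin n) ℝ) (j : ℕ) (σ : Matrix (Fin n) (Fin n) ℝ) :
    Matrix (Fin n) (Fin n) ℝ :=
  k * (tailProj n j * (tailBlock j (kᵀ * σ * k))⁻¹ * tailProj n j) * kᵀ

theorem differentiableAt_tailBlock (j : ℕ) (hS : DifferentiableAt ℝ S u) :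
    DifferentiableAt ℝ (fun w => tailBlock j (kᵀ * S w * k)) u := by
  unfold tailBlock
  fun_prop

theorem pd_tailBlock (j : ℕ) (hS : DifferentiableAt ℝ S u) (A : Fin m) :
    pd A (fun w => tailBlock j (kᵀ * S w * k)) u =
      tailProj n j * (kᵀ * pd A S u * k) * tailProj n j := by
  have h : (fun w => tailBlock j (kᵀ * S w * k)) =
      fun w => (tailProj n j * kᵀ) * S w * (k * tailProj n j) - (tailProj n j - 1) := by
    funext w; rw [tailBlock]; simp only [Matrix.mul_assoc]; abel
  rw [h, pd_sub (by fun_prop) (by fun_prop), pd_const, sub_zero, pd_sandwich _ _ hS]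
  simp only [Matrix.mul_assoc]

theorem posDef_congr {σ : Matrix (Fin n) (Fin n) ℝ} (hσ : σ.PosDef) (hk : IsUnit k) :
    (kᵀ * σ * k).PosDef := by
  have h := hσ.conjTranspose_mul_mul_same (B := k) (Matrix.mulVec_injective_of_isUnit hk)
  rwa [Matrix.conjTranspose_eq_transpose_of_trivial] at h

theorem contDiffAt_logdet_tailBlock (j : ℕ) (hS : ContDiffAt ℝ ∞ S u)
    (hu : (S u).PosDef) (hk : IsUnit k) :
    ContDiffAt ℝ ∞ (fun w => Real.log (tailBlock j (kᵀ * S w * k)).det) u := by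
  have h : ContDiffAt ℝ ∞ (fun w => tailBlock j (kᵀ * S w * k)) u := by
    unfold tailBlock
    exact ((contDiffAt_const.mul ((contDiffAt_const.mul hS).mul contDiffAt_const)).mul
      contDiffAt_const).add contDiffAt_const
  exact ContDiffAt.log (Matrix.contDiff_det.contDiffAt.comp u h)
    (det_tailBlock_pos (posDef_congr hu hk) j).ne'

theorem contDiffAt_logMinor (i : ℕ) (hS : ContDiffAt ℝ ∞ S u) (hu : (S u).PosDef)
    (hk : IsUnit k) : ContDiffAt ℝ ∞ (fun w => logMinor i (kᵀ * S w * k)) u :=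
  contDiffAt_const.mul ((contDiffAt_logdet_tailBlock i hS hu hk).sub
    (contDiffAt_logdet_tailBlock (i + 1) hS hu hk))

theorem pd_logdet_tailBlock (j : ℕ) (hS : DifferentiableAt ℝ S u) (hu : (S u).PosDef)
    (hk : IsUnit k) (A : Fin m) :
    pd A (fun w => Real.log (tailBlock j (kᵀ * S w * k)).det) u =
      (minorGrad k j (S u) * pd A S u).trace := by
  rw [pd_logdet (differentiableAt_tailBlock j hS) (det_tailBlock_pos (posDef_congr hu hk) j).ne',
    pd_tailBlock j hS, minorGrad]
  generalize (tailBlock j (kᵀ * S u * k))⁻¹ = N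
  generalize pd A S u = X
  generalize tailProj n j = p
  calc (N * (p * (kᵀ * X * k) * p)).trace = ((N * p * kᵀ * X) * (k * p)).trace := by
        simp only [Matrix.mul_assoc]
    _ = ((k * p) * (N * p * kᵀ * X)).trace := Matrix.trace_mul_comm _ _
    _ = _ := by simp only [Matrix.mul_assoc]

theorem isUnit_tailBlock {σ : Matrix (Fin n) (Fin n) ℝ} (hσ : σ.PosDef) (hk : IsUnit k) (j : ℕ) :
    IsUnit (tailBlock j (kᵀ * σ * k)) := by
  rw [Matrix.isUnit_iff_isUnit_det]
  exact (det_tailBlock_pos (posDef_congr hσ hk) j).ne'.isUnit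

theorem differentiableAt_minorGrad (j : ℕ) (hS : DifferentiableAt ℝ S u) (hu : (S u).PosDef)
    (hk : IsUnit k) : DifferentiableAt ℝ (fun w => minorGrad k j (S w)) u := by
  have h := differentiableAt_inv (differentiableAt_tailBlock (k := k) j hS)
    (isUnit_tailBlock hu hk j)
  unfold minorGrad
  fun_prop

/-- The derivative `-N dT N` of an inverse `N = T⁻¹` contains the compressed `dT`; the projections
and the factors `k`, `kᵀ` on its two sides complete each `N` to a gradient. -/
theorem pd_minorGrad (j : ℕ) (hS : DifferentiableAt ℝ S u) (hu : (S u).PosDef)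
    (hk : IsUnit k) (A : Fin m) :
    pd A (fun w => minorGrad k j (S w)) u =
      -(minorGrad k j (S u) * pd A S u * minorGrad k j (S u)) := by
  have hd := differentiableAt_tailBlock (k := k) j hS
  have hi := isUnit_tailBlock hu hk j
  have h : (fun w => minorGrad k j (S w)) =
      fun w => (k * tailProj n j) * (tailBlock j (kᵀ * S w * k))⁻¹ * (tailProj n j * kᵀ) := by
    funext w; simp only [minorGrad, Matrix.mul_assoc]
  rw [h, pd_sandwich _ _ (differentiableAt_inv hd hi), pd_inv hd hi, pd_tailBlock j hS]
  simp only [minorGrad, Matrix.mul_assoc, mul_neg, neg_mul]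

theorem pd_pd_logdet_tailBlock (j : ℕ) (hS : ∀ᶠ w in nhds u, ContDiffAt ℝ ∞ S w)
    (hu : ∀ w, (S w).PosDef) (hk : IsUnit k) (A B : Fin m) :
    pd A (pd B fun w => Real.log (tailBlock j (kᵀ * S w * k)).det) u =
      (minorGrad k j (S u) * pd A (pd B S) u).trace -
        (minorGrad k j (S u) * pd A S u * minorGrad k j (S u) * pd B S u).trace := by
  have h : (pd B fun w => Real.log (tailBlock j (kᵀ * S w * k)).det) =ᶠ[nhds u]
      fun w => (minorGrad k j (S w) * pd B S w).trace := by
    filter_upwards [hS] with w hw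
    exact pd_logdet_tailBlock j (hw.differentiableAt (by simp)) (hu w) hk B
  have hSu := hS.self_of_nhds
  have hd := hSu.differentiableAt (by simp)
  have h1 := differentiableAt_minorGrad j hd (hu u) hk
  have h2 := differentiableAt_pd hSu B
  rw [pd_congr h, pd_trace (h1.fun_mul h2), pd_mul h1 h2, pd_minorGrad j hd (hu u) hk,
    neg_mul, Matrix.trace_add, Matrix.trace_neg]
  ring

end Minors

/-! ### Factors of `σ` adapted to the minors, and consequences of `det σ = 1`. -/

section AdaptedFrame

variable {n : ℕ}

/-- With `h` the upper triangular factor of `kᵀσk`, take `g = (kᵀ)⁻¹h`. This one `g` turns the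
gradients of all the minors into coordinate projections simultaneously. -/
theorem exists_adapted_factor {σ k : Matrix (Fin n) (Fin n) ℝ} (hσ : σ.PosDef) (hk : IsUnit k) :
    ∃ g : Matrix (Fin n) (Fin n) ℝ, IsUnit g ∧ g * gᵀ = σ ∧
      ∀ j, gᵀ * minorGrad k j σ * g = tailProj n j := by
  obtain ⟨h, hh, hpos, he⟩ := exists_upper_cholesky (posDef_congr hσ hk)
  have hkd := (Matrix.isUnit_iff_isUnit_det _).1 hk
  have hktd : IsUnit (kᵀ).det := by rwa [Matrix.det_transpose]
  refine ⟨(kᵀ)⁻¹ * h, ?_, ?_, fun j => ?_⟩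
  · exact ((Matrix.isUnit_nonsing_inv_iff).2 ((Matrix.isUnit_iff_isUnit_det _).2 hktd)).mul
      (isUnit_of_upper hh hpos)
  · rw [Matrix.transpose_mul, Matrix.transpose_nonsing_inv, Matrix.transpose_transpose,
      Matrix.mul_assoc, ← Matrix.mul_assoc h, he, Matrix.mul_assoc, Matrix.mul_assoc,
      Matrix.mul_nonsing_inv _ hkd, mul_one, ← Matrix.mul_assoc, Matrix.nonsing_inv_mul _ hktd,
      one_mul]
  · have e1 : kᵀ * ((kᵀ)⁻¹ * h) = h := by
      rw [← Matrix.mul_assoc, Matrix.mul_nonsing_inv _ hktd, one_mul]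
    have e2 : ((kᵀ)⁻¹ * h)ᵀ * k = hᵀ := by
      rw [← Matrix.transpose_transpose k, ← Matrix.transpose_mul, Matrix.transpose_transpose, e1]
    rw [← tailProj_inv_tailBlock hh hpos j, he, minorGrad]
    generalize (tailProj n j * (tailBlock j (kᵀ * σ * k))⁻¹ * tailProj n j) = Q
    calc ((kᵀ)⁻¹ * h)ᵀ * (k * Q * kᵀ) * ((kᵀ)⁻¹ * h)
        = (((kᵀ)⁻¹ * h)ᵀ * k) * Q * (kᵀ * ((kᵀ)⁻¹ * h)) := by simp only [Matrix.mul_assoc]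
      _ = hᵀ * Q * h := by rw [e1, e2]

/-- Consecutive projections differ by the projection to the coordinate `i`; for the last `i` the
second one is zero. -/
theorem trace_tailProj_mul_sub (i : Fin n) (X : Matrix (Fin n) (Fin n) ℝ) :
    (tailProj n i * X).trace - (tailProj n (i + 1) * X).trace = X i i := by
  rw [← Matrix.trace_sub, Matrix.trace, Finset.sum_eq_single i]
  · simp [tailProj_mul_apply]
  · intro b _ hb
    have : (b : ℕ) ≠ i := fun h => hb (Fin.ext h)
    simp only [Matrix.diag_apply, Matrix.sub_apply, tailProj_mul_apply]
    by_cases h1 : (i : ℕ) ≤ b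
    · rw [if_pos h1, if_pos (by omega), sub_self]
    · rw [if_neg h1, if_neg (by omega), sub_self]
  · simp

variable {m : ℕ} {S : (Fin m → ℝ) → Matrix (Fin n) (Fin n) ℝ} {u : Fin m → ℝ}
  {k : Matrix (Fin n) (Fin n) ℝ}

theorem pd_transpose {F : (Fin m → ℝ) → Matrix (Fin n) (Fin n) ℝ} (hF : DifferentiableAt ℝ F u)
    (hs : ∀ᶠ w in nhds u, (F w)ᵀ = F w) (A : Fin m) : (pd A F u)ᵀ = pd A F u := by
  ext i j
  rw [Matrix.transpose_apply, ← pd_entry hF, ← pd_entry hF]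
  exact pd_congr (hs.mono fun w hw => congrFun (congrFun hw i) j)

theorem pd_pd_transpose (hS : ∀ᶠ w in nhds u, ContDiffAt ℝ ∞ S w) (hs : ∀ w, (S w)ᵀ = S w)
    (A B : Fin m) : (pd A (pd B S) u)ᵀ = pd A (pd B S) u :=
  pd_transpose (differentiableAt_pd hS.self_of_nhds B) (hS.mono fun _ hw =>
    pd_transpose (hw.differentiableAt (by simp)) (Filter.Eventually.of_forall hs) B) A

theorem trace_logPd (hS : DifferentiableAt ℝ S u) (hdet : ∀ w, (S w).det = 1) (A : Fin m) :
    (logPd S A u).trace = 0 := by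
  have h := pd_logdet (A := A) hS (by rw [hdet]; exact one_ne_zero)
  simp only [hdet, Real.log_one, pd_const] at h
  exact h.symm

/-- Differentiate `tr(S⁻¹ ∂_B S) = 0`, which holds because `det S` is constant. -/
theorem trace_inv_mul_pd_pd (hS : ∀ᶠ w in nhds u, ContDiffAt ℝ ∞ S w)
    (hdet : ∀ w, (S w).det = 1) (A B : Fin m) :
    ((S u)⁻¹ * pd A (pd B S) u).trace = (logPd S A u * logPd S B u).trace := by
  have hSu := hS.self_of_nhds
  have hu : IsUnit (S u) := by rw [Matrix.isUnit_iff_isUnit_det, hdet]; exact isUnit_one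
  have h : (fun w => (logPd S B w).trace) =ᶠ[nhds u] fun _ => 0 := by
    filter_upwards [hS] with w hw
    exact trace_logPd (hw.differentiableAt (by simp)) hdet B
  have h2 := pd_congr (A := A) h
  rw [pd_trace (differentiableAt_logPd hSu hu B), pd_logPd hSu hu, pd_const,
    Matrix.trace_sub] at h2
  linarith

end AdaptedFrame

/-! ### Covariant Hessian of the logarithmic minors. -/

section AdaptedFrameHessian

variable {n : ℕ} {S : (Fin (dim n) → ℝ) → Matrix (Fin n) (Fin n) ℝ} {u : Fin (dim n) → ℝ}
  {k : Matrix (Fin n) (Fin n) ℝ}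

/-- At every point there is a frame in which the first derivatives and the covariant Hessians of
the functions `logMinor i` take a normal form. -/
theorem exists_adapted_frame (hn : 0 < n) {c : ℝ} (hc : 0 < c)
    (hS : ∀ᶠ w in nhds u, ContDiffAt ℝ ∞ S w) (hpd : ∀ w, (S w).PosDef)
    (hdet : ∀ w, (S w).det = 1) (himm : LinearIndependent ℝ fun A => pd A S u) (hk : IsUnit k) :
    ∃ Y : Fin (dim n) → Matrix (Fin n) (Fin n) ℝ, LinearIndependent ℝ Y ∧
      (∀ A, Y A ∈ tracelessSym n) ∧ (traceGram c fun E => logPd S E u) = traceGram c Y ∧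
      (∀ (i : Fin n) A, pd A (fun w => logMinor i (kᵀ * S w * k)) u = 1 / 2 * Y A i i) ∧
      ∀ (i : Fin n) A B, pd A (pd B fun w => logMinor i (kᵀ * S w * k)) u -
        ∑ C, christoffel (fun w => traceGram c fun E => logPd S E w) C A B u *
          pd C (fun w => logMinor i (kᵀ * S w * k)) u =
        1 / 2 * (1 / 2 * ((Y A * Y B) i i + (Y B * Y A) i i) -
          ((tailProj n i * Y A * tailProj n i * Y B).trace -
            (tailProj n (i + 1) * Y A * tailProj n (i + 1) * Y B).trace)) := by
  have hs : ∀ w, (S w)ᵀ = S w := fun w => by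
    have := (hpd w).1.eq
    rwa [Matrix.conjTranspose_eq_transpose_of_trivial] at this
  have hSu := hS.self_of_nhds
  have hd := hSu.differentiableAt (by simp)
  have hu : IsUnit (S u) := by rw [Matrix.isUnit_iff_isUnit_det, hdet]; exact isUnit_one
  obtain ⟨g, hg, hgS, hgp⟩ := exists_adapted_factor (hpd u) hk
  have hgd := (Matrix.isUnit_iff_isUnit_det _).1 hg
  have hgtd : IsUnit (gᵀ).det := by rwa [Matrix.det_transpose]
  -- `R X` is conjugate to `σ⁻¹X`, so traces of products agree, but unlike `σ⁻¹X` it is symmetric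
  -- whenever `X` is.
  set R : Matrix (Fin n) (Fin n) ℝ → Matrix (Fin n) (Fin n) ℝ := fun X => g⁻¹ * X * (gᵀ)⁻¹ with hR
  have hRinv : ∀ X, g * R X * gᵀ = X := fun X => by
    calc g * (g⁻¹ * X * (gᵀ)⁻¹) * gᵀ = (g * g⁻¹) * X * ((gᵀ)⁻¹ * gᵀ) := by
          simp only [Matrix.mul_assoc]
      _ = X := by
          rw [Matrix.mul_nonsing_inv _ hgd, Matrix.nonsing_inv_mul _ hgtd, one_mul, mul_one]
  have hRt : ∀ X, Xᵀ = X → (R X)ᵀ = R X := fun X hX => by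
    simp only [hR, Matrix.transpose_mul, hX, Matrix.transpose_nonsing_inv,
      Matrix.transpose_transpose, Matrix.mul_assoc]
  have hNR : ∀ X, (S u)⁻¹ * X = (gᵀ)⁻¹ * R X * gᵀ := fun X => by
    rw [← hgS, Matrix.mul_inv_rev]
    calc (gᵀ)⁻¹ * g⁻¹ * X = (gᵀ)⁻¹ * g⁻¹ * X * ((gᵀ)⁻¹ * gᵀ) := by
          rw [Matrix.nonsing_inv_mul _ hgtd, mul_one]
      _ = _ := by simp only [hR, Matrix.mul_assoc]
  have hconj : ∀ X Z : Matrix (Fin n) (Fin n) ℝ,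
      ((gᵀ)⁻¹ * X * gᵀ) * ((gᵀ)⁻¹ * Z * gᵀ) = (gᵀ)⁻¹ * (X * Z) * gᵀ := fun X Z => by
    calc _ = (gᵀ)⁻¹ * X * (gᵀ * (gᵀ)⁻¹) * Z * gᵀ := by simp only [Matrix.mul_assoc]
      _ = _ := by rw [Matrix.mul_nonsing_inv _ hgtd, mul_one]; simp only [Matrix.mul_assoc]
  have htr : ∀ X : Matrix (Fin n) (Fin n) ℝ, ((gᵀ)⁻¹ * X * gᵀ).trace = X.trace := fun X => by
    rw [Matrix.trace_mul_comm, ← Matrix.mul_assoc, Matrix.mul_nonsing_inv _ hgtd, one_mul]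
  set Y : Fin (dim n) → Matrix (Fin n) (Fin n) ℝ := fun A => R (pd A S u) with hY
  have hV : ∀ A, logPd S A u = (gᵀ)⁻¹ * Y A * gᵀ := fun A => hNR _
  have hYmem : ∀ A, Y A ∈ tracelessSym n := fun A =>
    ⟨hRt _ (pd_transpose hd (Filter.Eventually.of_forall hs) A), by
      rw [← htr, ← hV, trace_logPd hd hdet]⟩
  have hYli : LinearIndependent ℝ Y := by
    rw [Fintype.linearIndependent_iff] at himm ⊢
    intro x hx
    refine himm x ?_
    have : ∑ A, x A • pd A S u = g * (∑ A, x A • Y A) * gᵀ := by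
      rw [Finset.mul_sum, Finset.sum_mul]
      refine Finset.sum_congr rfl fun A _ => ?_
      rw [Matrix.mul_smul, Matrix.smul_mul, hRinv]
    rw [this, hx, mul_zero, zero_mul]
  have hgram : (traceGram c fun E => logPd S E u) = traceGram c Y := by
    ext A B
    simp only [traceGram, Matrix.of_apply, hV, hconj, htr]
  have hgrad : ∀ (j : ℕ) X, (minorGrad k j (S u) * X).trace = (tailProj n j * R X).trace :=
    fun j X => by
    rw [← hgp j]
    conv_lhs => rw [← hRinv X]
    rw [Matrix.trace_mul_comm, Matrix.mul_assoc, Matrix.mul_assoc, Matrix.trace_mul_comm,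
      Matrix.trace_mul_comm _ (R X)]
    simp only [Matrix.mul_assoc]
  have hgrad2 : ∀ (j : ℕ) A B,
      (minorGrad k j (S u) * pd A S u * minorGrad k j (S u) * pd B S u).trace =
        (tailProj n j * Y A * tailProj n j * Y B).trace := fun j A B => by
    rw [← hgp j]
    conv_lhs => rw [← hRinv (pd A S u), ← hRinv (pd B S u)]
    change _ = (gᵀ * minorGrad k j (S u) * g * R (pd A S u) * (gᵀ * minorGrad k j (S u) * g) *
      R (pd B S u)).trace
    generalize minorGrad k j (S u) = P
    generalize R (pd A S u) = a
    generalize R (pd B S u) = b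
    calc (P * (g * a * gᵀ) * P * (g * b * gᵀ)).trace
        = ((P * g * a * gᵀ * P * g * b) * gᵀ).trace := by simp only [Matrix.mul_assoc]
      _ = (gᵀ * (P * g * a * gᵀ * P * g * b)).trace := Matrix.trace_mul_comm _ _
      _ = _ := by simp only [Matrix.mul_assoc]
  have hlogd : ∀ (j : ℕ) w, ContDiffAt ℝ ∞ S w →
      DifferentiableAt ℝ (fun w => Real.log (tailBlock j (kᵀ * S w * k)).det) w := fun j w hw =>
    (contDiffAt_logdet_tailBlock j hw (hpd w) hk).differentiableAt (by simp)
  have hpdφ : ∀ (i : ℕ) A w, ContDiffAt ℝ ∞ S w →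
      pd A (fun w => logMinor i (kᵀ * S w * k)) w =
      1 / 2 * (pd A (fun w => Real.log (tailBlock i (kᵀ * S w * k)).det) w -
        pd A (fun w => Real.log (tailBlock (i + 1) (kᵀ * S w * k)).det) w) := fun i A w hw => by
    rw [← pd_sub (hlogd _ w hw) (hlogd _ w hw)]
    exact pd_clm ((1 / 2 : ℝ) • ContinuousLinearMap.id ℝ ℝ)
      ((hlogd i w hw).fun_sub (hlogd (i + 1) w hw))
  have hfirst : ∀ (i : Fin n) A, pd A (fun w => logMinor i (kᵀ * S w * k)) u =
      1 / 2 * Y A i i := fun i A => by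
    rw [hpdφ _ _ _ hSu, pd_logdet_tailBlock _ hd (hpd u) hk, pd_logdet_tailBlock _ hd (hpd u) hk,
      hgrad, hgrad, trace_tailProj_mul_sub]
  refine ⟨Y, hYli, hYmem, hgram, hfirst, fun i A B => ?_⟩
  have hsecond : pd A (pd B fun w => logMinor i (kᵀ * S w * k)) u =
      1 / 2 * (R (pd A (pd B S) u) i i -
          ((tailProj n i * Y A * tailProj n i * Y B).trace -
            (tailProj n (i + 1) * Y A * tailProj n (i + 1) * Y B).trace)) := by
    have hev : (pd B fun w => logMinor i (kᵀ * S w * k)) =ᶠ[nhds u] fun w => 1 / 2 *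
        (pd B (fun w => Real.log (tailBlock i (kᵀ * S w * k)).det) w -
          pd B (fun w => Real.log (tailBlock (i + 1) (kᵀ * S w * k)).det) w) :=
      hS.mono fun w hw => hpdφ i B w hw
    have hdd : ∀ j : ℕ, DifferentiableAt ℝ
        (pd B fun w => Real.log (tailBlock j (kᵀ * S w * k)).det) u := fun j =>
      (contDiffAt_pd (contDiffAt_logdet_tailBlock j hSu (hpd u) hk)).differentiableAt (by simp)
    rw [pd_congr hev]
    refine (pd_clm ((1 / 2 : ℝ) • ContinuousLinearMap.id ℝ ℝ)
      ((hdd i).fun_sub (hdd (i + 1)))).trans ?_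
    rw [pd_sub (hdd i) (hdd (i + 1)), pd_pd_logdet_tailBlock _ hS hpd hk,
      pd_pd_logdet_tailBlock _ hS hpd hk, hgrad, hgrad, hgrad2, hgrad2,
      ← trace_tailProj_mul_sub i (R _)]
    simp only [_root_.smul_apply, ContinuousLinearMap.id_apply, smul_eq_mul]
    ring
  -- `W` is the combination of the `Y C` with the Christoffel symbols as coefficients. Subtracting
  -- its diagonal entry removes the second derivatives of `S` from the Hessian, leaving a quadratic
  -- expression in the frame.
  set W := R (pd A (pd B S) u) - (1 / 2 : ℝ) • (Y A * Y B + Y B * Y A) with hWdef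
  have hW : W ∈ tracelessSym n := by
    refine ⟨?_, ?_⟩
    · rw [hWdef, Matrix.transpose_sub, hRt _ (pd_pd_transpose hS hs A B), Matrix.transpose_smul,
        Matrix.transpose_add, Matrix.transpose_mul (Y A), Matrix.transpose_mul (Y B), (hYmem A).1,
        (hYmem B).1, add_comm]
    · have h := trace_inv_mul_pd_pd hS hdet A B
      rw [hNR, htr, hV, hV, hconj, htr] at h
      rw [hWdef, Matrix.trace_sub, Matrix.trace_smul, Matrix.trace_add, h,
        Matrix.trace_mul_comm (Y B), smul_eq_mul]
      ring
  have hΓ : ∑ C, christoffel (fun w => traceGram c fun E => logPd S E w) C A B u • Y C = W := by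
    rw [← frame_expansion hn hc hYli hYmem hW]
    refine Finset.sum_congr rfl fun C _ => ?_
    rw [christoffel_traceGram_logPd c hSu hu, hgram]
    congr 1
    refine Finset.sum_congr rfl fun D _ => ?_
    congr 2
    rw [hV, hV, hV, hNR, hconj, hconj, ← Matrix.add_mul, ← Matrix.mul_add, ← Matrix.smul_mul,
      ← Matrix.mul_smul, ← Matrix.sub_mul, ← Matrix.mul_sub, hconj, htr]
  have hΓi := congrFun (congrFun hΓ i) i
  simp only [Matrix.sum_apply, Matrix.smul_apply, smul_eq_mul] at hΓi
  simp only [hfirst]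
  have : ∑ C, christoffel (fun w => traceGram c fun E => logPd S E w) C A B u *
      (1 / 2 * Y C i i) = 1 / 2 * W i i := by
    rw [← hΓi, Finset.mul_sum]
    exact Finset.sum_congr rfl fun C _ => by ring
  rw [this, hsecond, hWdef]
  simp only [Matrix.sub_apply, Matrix.smul_apply, Matrix.add_apply, smul_eq_mul]
  ring

end AdaptedFrameHessian

/-! ### Contractions with the inverse Gram matrix. -/

section FrameSums

variable {n : ℕ}

theorem sum_sum_mul_sum {ι κ R : Type*} [Fintype ι] [CommSemiring R] (s : Finset κ)
    (g : ι → ι → R) (f : κ → ι → ι → R) :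
    ∑ A, ∑ B, g A B * ∑ x ∈ s, f x A B = ∑ x ∈ s, ∑ A, ∑ B, g A B * f x A B := by
  simp only [Finset.mul_sum]
  rw [Finset.sum_comm]
  conv_rhs => rw [Finset.sum_comm]
  rw [Finset.sum_comm]
  exact Finset.sum_congr rfl fun A _ => Finset.sum_comm

theorem sum_le_val (j : ℕ) (hj : j ≤ n) :
    ∑ a : Fin n, (if j ≤ (a : ℕ) then (1 : ℝ) else 0) = n - j := by
  rw [Fin.sum_univ_eq_sum_range (fun a => if j ≤ a then (1 : ℝ) else 0), Finset.sum_boole]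
  have : (Finset.range n).filter (fun a => j ≤ a) = Finset.Ico j n := by
    ext a; simp [and_comm]
  rw [this, Nat.card_Ico, Nat.cast_sub hj]

variable {c : ℝ} {Y : Fin (dim n) → Matrix (Fin n) (Fin n) ℝ}

theorem frame_sum_diag (hn : 0 < n) (hc : 0 < c)
    (hY : LinearIndependent ℝ Y) (hmem : ∀ A, Y A ∈ tracelessSym n) (i j : Fin n) :
    ∑ A, ∑ B, (traceGram c Y)⁻¹ A B * (Y A i i * Y B j j) =
      c⁻¹ * ((if i = j then 1 else 0) - 1 / n) := by
  rw [frame_completeness hn hc hY hmem]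
  by_cases h : i = j <;> simp [h]

theorem frame_sum_mul (hn : 0 < n) (hc : 0 < c)
    (hY : LinearIndependent ℝ Y) (hmem : ∀ A, Y A ∈ tracelessSym n) (i : Fin n) :
    ∑ A, ∑ B, (traceGram c Y)⁻¹ A B * (Y A * Y B) i i = c⁻¹ * (1 / 2 + n / 2 - 1 / n) := by
  simp only [Matrix.mul_apply]
  refine (sum_sum_mul_sum Finset.univ (fun A B => (traceGram c Y)⁻¹ A B)
    (fun a A B => Y A i a * Y B a i)).trans ?_
  simp only [frame_completeness hn hc hY hmem]
  have h : ∀ a : Fin n, (i = a ∧ a = i) ↔ i = a := fun a => ⟨fun h => h.1, fun h => ⟨h, h.symm⟩⟩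
  simp only [h, and_self, if_true, ← Finset.mul_sum, Finset.sum_sub_distrib, ← Finset.sum_div,
    Finset.sum_add_distrib, Finset.sum_ite_eq, Finset.mem_univ, Finset.sum_const,
    Finset.card_univ, Fintype.card_fin, nsmul_eq_mul, mul_one]
  ring

/-- Completeness is summed over the entries `(a, b)` and `(b, a)` with `a, b ≥ j`: the `n - j`
diagonal pairs give the linear term, all `(n - j)²` pairs the quadratic one. The case `j = n`, where
both sides vanish, is used for the last minor. -/
theorem frame_sum_trace_tailProj (hn : 0 < n) (hc : 0 < c)
    (hY : LinearIndependent ℝ Y) (hmem : ∀ A, Y A ∈ tracelessSym n) (j : ℕ) (hj : j ≤ n) :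
    ∑ A, ∑ B, (traceGram c Y)⁻¹ A B * (tailProj n j * Y A * tailProj n j * Y B).trace =
      c⁻¹ * ((1 / 2 - 1 / n) * (n - j) + (n - j) ^ 2 / 2) := by
  have h1 : ∀ A B, (tailProj n j * Y A * tailProj n j * Y B).trace =
      ∑ x : Fin n × Fin n, (if j ≤ x.1 then (1 : ℝ) else 0) * (if j ≤ x.2 then 1 else 0) *
        (Y A x.1 x.2 * Y B x.2 x.1) := by
    intro A B
    rw [Fintype.sum_prod_type, Matrix.trace]
    refine Finset.sum_congr rfl fun a _ => ?_
    rw [Matrix.diag_apply, Matrix.mul_apply]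
    refine Finset.sum_congr rfl fun b _ => ?_
    rw [mul_tailProj_apply, tailProj_mul_apply]
    split_ifs <;> simp
  simp only [h1]
  refine (sum_sum_mul_sum Finset.univ (fun A B => (traceGram c Y)⁻¹ A B)
    (fun (x : Fin n × Fin n) A B => (if j ≤ x.1 then (1 : ℝ) else 0) * (if j ≤ x.2 then 1 else 0) *
        (Y A x.1 x.2 * Y B x.2 x.1))).trans ?_
  have h2 : ∀ x : Fin n × Fin n, ∑ A, ∑ B, (traceGram c Y)⁻¹ A B *
      ((if j ≤ x.1 then (1 : ℝ) else 0) * (if j ≤ x.2 then 1 else 0) *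
        (Y A x.1 x.2 * Y B x.2 x.1)) = c⁻¹ *
      ((1 / 2 - 1 / n) * (if x.1 = x.2 then (if j ≤ x.1 then (1 : ℝ) else 0) else 0) +
        1 / 2 * ((if j ≤ x.1 then (1 : ℝ) else 0) * (if j ≤ x.2 then 1 else 0))) := by
    rintro ⟨a, b⟩
    have h3 : (a = b ∧ b = a) ↔ a = b := ⟨fun h => h.1, fun h => ⟨h, h.symm⟩⟩
    have h4 := frame_completeness hn hc hY hmem a b b a
    simp only [h3, and_self, if_true] at h4
    have h5 : ∀ q : ℝ, ∑ A, ∑ B, (traceGram c Y)⁻¹ A B * (q * (Y A a b * Y B b a)) =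
        q * ∑ A, ∑ B, (traceGram c Y)⁻¹ A B * (Y A a b * Y B b a) := by
      intro q
      simp only [Finset.mul_sum]
      exact Finset.sum_congr rfl fun A _ => Finset.sum_congr rfl fun B _ => by ring
    rw [h5, h4]
    by_cases hab : a = b
    · subst hab
      simp only [if_true]
      split_ifs <;> ring
    · simp only [if_neg hab]
      split_ifs <;> ring
  simp only [h2]
  rw [← Finset.mul_sum, Finset.sum_add_distrib, ← Finset.mul_sum, ← Finset.mul_sum,
    Fintype.sum_prod_type, Fintype.sum_prod_type]
  have h6 : ∑ x : Fin n, ∑ y : Fin n, (if j ≤ (x : ℕ) then (1 : ℝ) else 0) *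
      (if j ≤ (y : ℕ) then 1 else 0) = (n - j) * (n - j) := by
    refine (Finset.sum_mul_sum _ _ (fun x : Fin n => if j ≤ (x : ℕ) then (1 : ℝ) else 0)
      (fun y : Fin n => if j ≤ (y : ℕ) then (1 : ℝ) else 0)).symm.trans ?_
    rw [sum_le_val j hj]
  simp only [h6, Finset.sum_ite_eq, Finset.mem_univ, if_true, sum_le_val j hj]
  ring

/-- The sum over a frame of the covariant Hessian of `logMinor i`. -/
theorem frame_sum_hessian (hn : 0 < n) (hc : 0 < c)
    (hY : LinearIndependent ℝ Y) (hmem : ∀ A, Y A ∈ tracelessSym n) (i : Fin n) :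
    ∑ A, ∑ B, (traceGram c Y)⁻¹ A B *
      (1 / 2 * (1 / 2 * ((Y A * Y B) i i + (Y B * Y A) i i) -
          ((tailProj n i * Y A * tailProj n i * Y B).trace -
            (tailProj n (i + 1) * Y A * tailProj n (i + 1) * Y B).trace))) =
      -(((n - 1) / 2 - i) / (2 * c)) := by
  have hsymm : ∀ A B, (Y B * Y A) i i = (Y A * Y B) i i := fun A B => by
    rw [← Matrix.transpose_apply (Y B * Y A), Matrix.transpose_mul, (hmem A).1, (hmem B).1]
  have hsplit : ∀ A B, (traceGram c Y)⁻¹ A B *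
      (1 / 2 * (1 / 2 * ((Y A * Y B) i i + (Y B * Y A) i i) -
          ((tailProj n i * Y A * tailProj n i * Y B).trace -
            (tailProj n (i + 1) * Y A * tailProj n (i + 1) * Y B).trace))) =
      1 / 2 * ((traceGram c Y)⁻¹ A B * (Y A * Y B) i i) -
        1 / 2 * ((traceGram c Y)⁻¹ A B * (tailProj n i * Y A * tailProj n i * Y B).trace) +
        1 / 2 * ((traceGram c Y)⁻¹ A B *
          (tailProj n (i + 1) * Y A * tailProj n (i + 1) * Y B).trace) := fun A B => by
    rw [hsymm]; ring
  simp only [hsplit, Finset.sum_add_distrib, Finset.sum_sub_distrib, ← Finset.mul_sum]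
  -- The `1/n` terms cancel, and the difference of the quadratics at `i` and `i + 1` is linear in
  -- `i`; this is how the coordinates of `ρ` enter.
  rw [frame_sum_mul hn hc hY hmem, frame_sum_trace_tailProj hn hc hY hmem i i.2.le,
    frame_sum_trace_tailProj hn hc hY hmem (i + 1) i.2]
  have hn' : (n : ℝ) ≠ 0 := by exact_mod_cast hn.ne'
  push_cast
  field_simp
  ring

end FrameSums

/-! ### The Laplacian of exponentials of logarithmic minors. -/

section Laplacian

variable {n : ℕ} {S : (Fin (dim n) → ℝ) → Matrix (Fin n) (Fin n) ℝ} {u : Fin (dim n) → ℝ}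
  {k : Matrix (Fin n) (Fin n) ℝ}

theorem _root_.LocalRiem.pd_sum_mul_ofReal {m : ℕ} {ι : Type*} [Fintype ι] (a : ι → ℂ)
    {φ : ι → (Fin m → ℝ) → ℝ} {u : Fin m → ℝ} (hφ : ∀ i, DifferentiableAt ℝ (φ i) u)
    (A : Fin m) :
    pd A (fun w => ∑ i, a i * (φ i w : ℂ)) u = ∑ i, a i * ((pd A (φ i) u : ℝ) : ℂ) := by
  have hd : ∀ i, DifferentiableAt ℝ (fun w => (φ i w : ℂ)) u := fun i =>
    Complex.ofRealCLM.differentiableAt.comp u (hφ i)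
  rw [pd_sum _ fun i _ => (hd i).const_mul (a i)]
  refine Finset.sum_congr rfl fun i _ => ?_
  rw [pd_mul (differentiableAt_const _) (hd i), pd_const, zero_mul, zero_add]
  congr 1
  exact pd_clm Complex.ofRealCLM (hφ i)

/-- For `f = ∑ a_i φ_i`, `Δ e^f = e^f (⟨∇f,∇f⟩ + Δf)` with the complex bilinear extension of the
metric. The `1/n` part of `⟨∇φ_i,∇φ_j⟩` contributes `(∑ a_i)²`, which `ha` removes. -/
theorem laplace_cexp_logMinor (hn : 0 < n) {c : ℝ} (hc : 0 < c)
    (hS : ∀ᶠ w in nhds u, ContDiffAt ℝ ∞ S w) (hpd : ∀ w, (S w).PosDef)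
    (hdet : ∀ w, (S w).det = 1) (himm : LinearIndependent ℝ fun A => pd A S u) (hk : IsUnit k)
    (a : Fin n → ℂ) (ha : ∑ i, a i = 0) :
    laplace (fun w => traceGram c fun E => logPd S E w)
        (fun w => Complex.exp (∑ i : Fin n, a i * (logMinor i (kᵀ * S w * k) : ℂ))) u =
      (∑ i, a i ^ 2 - 2 * ∑ i : Fin n, a i * (((n - 1) / 2 - i : ℝ) : ℂ)) / (4 * c) *
        Complex.exp (∑ i : Fin n, a i * (logMinor i (kᵀ * S u * k) : ℂ)) := by
  obtain ⟨Y, hYli, hYmem, hgram, hfirst, hsecond⟩ :=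
    exists_adapted_frame hn hc hS hpd hdet himm hk
  set φ : Fin n → (Fin (dim n) → ℝ) → ℝ := fun i w => logMinor i (kᵀ * S w * k) with hφ
  change laplace _ (fun w => Complex.exp (∑ i : Fin n, a i * (φ i w : ℂ))) u = _ *
    Complex.exp (∑ i : Fin n, a i * (φ i u : ℂ))
  replace hfirst : ∀ i A, pd A (φ i) u = 1 / 2 * Y A i i := hfirst
  replace hsecond : ∀ i A B, pd A (pd B (φ i)) u -
        ∑ C, christoffel (fun w => traceGram c fun E => logPd S E w) C A B u * pd C (φ i) u =
        1 / 2 * (1 / 2 * ((Y A * Y B) i i + (Y B * Y A) i i) -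
          ((tailProj n i * Y A * tailProj n i * Y B).trace -
            (tailProj n (i + 1) * Y A * tailProj n (i + 1) * Y B).trace)) := hsecond
  have hsmooth : ∀ i w, ContDiffAt ℝ ∞ S w → ContDiffAt ℝ ∞ (φ i) w := fun i w hw =>
    contDiffAt_logMinor i hw (hpd w) hk
  have hSu := hS.self_of_nhds
  have hexp : ∀ B w, ContDiffAt ℝ ∞ S w →
      pd B (fun w => Complex.exp (∑ i : Fin n, a i * (φ i w : ℂ))) w =
        Complex.exp (∑ i : Fin n, a i * (φ i w : ℂ)) * ∑ i, a i * ((pd B (φ i) w : ℝ) : ℂ) := by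
    intro B w hw
    have hd : ∀ i, DifferentiableAt ℝ (φ i) w := fun i =>
      (hsmooth i w hw).differentiableAt (by simp)
    rw [pd_cexp, pd_sum_mul_ofReal a hd]
    exact DifferentiableAt.fun_sum fun i _ =>
      (Complex.ofRealCLM.differentiableAt.comp w (hd i)).const_mul (a i)
  have hdu : ∀ i, DifferentiableAt ℝ (φ i) u := fun i =>
    (hsmooth i u hSu).differentiableAt (by simp)
  have hddu : ∀ B i, DifferentiableAt ℝ (pd B (φ i)) u := fun B i =>
    (contDiffAt_pd (hsmooth i u hSu)).differentiableAt (by simp)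
  have hexp2 : ∀ A B, pd A (pd B fun w => Complex.exp (∑ i : Fin n, a i * (φ i w : ℂ))) u =
      Complex.exp (∑ i : Fin n, a i * (φ i u : ℂ)) *
        ((∑ i, a i * ((pd A (φ i) u : ℝ) : ℂ)) * (∑ i, a i * ((pd B (φ i) u : ℝ) : ℂ)) +
          ∑ i, a i * ((pd A (pd B (φ i)) u : ℝ) : ℂ)) := by
    intro A B
    have hev : (pd B fun w => Complex.exp (∑ i : Fin n, a i * (φ i w : ℂ))) =ᶠ[nhds u]
        fun w => Complex.exp (∑ i : Fin n, a i * (φ i w : ℂ)) * ∑ i, a i * ((pd B (φ i) w : ℝ) : ℂ) :=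
      hS.mono fun w hw => hexp B w hw
    have h1 : DifferentiableAt ℝ (fun w => ∑ i : Fin n, a i * (φ i w : ℂ)) u :=
      DifferentiableAt.fun_sum fun i _ =>
        (Complex.ofRealCLM.differentiableAt.comp u (hdu i)).const_mul (a i)
    have h2 : DifferentiableAt ℝ (fun w => ∑ i : Fin n, a i * ((pd B (φ i) w : ℝ) : ℂ)) u :=
      DifferentiableAt.fun_sum fun i _ =>
        (Complex.ofRealCLM.differentiableAt.comp u (hddu B i)).const_mul (a i)
    rw [pd_congr hev, pd_mul h1.cexp h2, pd_cexp h1, pd_sum_mul_ofReal a hdu,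
      pd_sum_mul_ofReal a (hddu B)]
    ring
  have hterm : ∀ A B, pd A (pd B fun w => Complex.exp (∑ i : Fin n, a i * (φ i w : ℂ))) u -
      ∑ C, ((christoffel (fun w => traceGram c fun E => logPd S E w) C A B u : ℝ) : ℂ) *
        pd C (fun w => Complex.exp (∑ i : Fin n, a i * (φ i w : ℂ))) u =
      Complex.exp (∑ i : Fin n, a i * (φ i u : ℂ)) *
        (∑ x : Fin n × Fin n, a x.1 * a x.2 * (1 / 4) * ((Y A x.1 x.1 * Y B x.2 x.2 : ℝ) : ℂ) +
          ∑ i, a i * ((pd A (pd B (φ i)) u -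
            ∑ C, christoffel (fun w => traceGram c fun E => logPd S E w) C A B u *
              pd C (φ i) u : ℝ) : ℂ)) := by
    intro A B
    have e1 : ∑ C, ((christoffel (fun w => traceGram c fun E => logPd S E w) C A B u : ℝ) : ℂ) *
        pd C (fun w => Complex.exp (∑ i : Fin n, a i * (φ i w : ℂ))) u =
        Complex.exp (∑ i : Fin n, a i * (φ i u : ℂ)) * ∑ i, a i *
          ((∑ C, christoffel (fun w => traceGram c fun E => logPd S E w) C A B u *
              pd C (φ i) u : ℝ) : ℂ) := by
      simp only [hexp _ u hSu, Complex.ofReal_sum, Complex.ofReal_mul, Finset.mul_sum]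
      rw [Finset.sum_comm]
      exact Finset.sum_congr rfl fun i _ => Finset.sum_congr rfl fun C _ => by ring
    have e2 : (∑ i, a i * ((pd A (φ i) u : ℝ) : ℂ)) * (∑ i, a i * ((pd B (φ i) u : ℝ) : ℂ)) =
        ∑ x : Fin n × Fin n, a x.1 * a x.2 * (1 / 4) *
          ((Y A x.1 x.1 * Y B x.2 x.2 : ℝ) : ℂ) := by
      rw [Finset.sum_mul_sum, ← Fintype.sum_prod_type']
      refine Finset.sum_congr rfl fun x _ => ?_
      rw [hfirst, hfirst]
      push_cast
      ring
    rw [hexp2, e1, e2]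
    simp only [Complex.ofReal_sub, mul_sub, mul_add, Finset.sum_sub_distrib]
    ring
  have hreal : ∀ (f : Fin (dim n) → Fin (dim n) → ℝ) (q : ℂ),
      ∑ A, ∑ B, (((traceGram c Y)⁻¹ A B : ℝ) : ℂ) * (q * (f A B : ℂ)) =
        q * ((∑ A, ∑ B, (traceGram c Y)⁻¹ A B * f A B : ℝ) : ℂ) := by
    intro f q
    simp only [Complex.ofReal_sum, Complex.ofReal_mul, Finset.mul_sum]
    exact Finset.sum_congr rfl fun A _ => Finset.sum_congr rfl fun B _ => by ring
  unfold laplace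
  simp only [hterm, hgram]
  have hpull : ∀ (E : ℂ) (f : Fin (dim n) → Fin (dim n) → ℂ),
      ∑ A, ∑ B, (((traceGram c Y)⁻¹ A B : ℝ) : ℂ) * (E * f A B) =
        (∑ A, ∑ B, (((traceGram c Y)⁻¹ A B : ℝ) : ℂ) * f A B) * E := by
    intro E f
    simp only [Finset.sum_mul]
    exact Finset.sum_congr rfl fun A _ => Finset.sum_congr rfl fun B _ => by ring
  rw [hpull]
  congr 1
  simp only [mul_add, Finset.sum_add_distrib]
  rw [sum_sum_mul_sum, sum_sum_mul_sum]
  simp only [hreal, hsecond, frame_sum_diag hn hc hYli hYmem, frame_sum_hessian hn hc hYli hYmem]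
  have hc' : (c : ℂ) ≠ 0 := by exact_mod_cast hc.ne'
  have hsq : ∑ x : Fin n × Fin n, a x.1 * a x.2 * (1 / 4) *
      ((c⁻¹ * ((if x.1 = x.2 then 1 else 0) - 1 / n) : ℝ) : ℂ) = (∑ i, a i ^ 2) / (4 * c) := by
    have h1 : ∀ i j : Fin n, a i * a j * (1 / 4) *
        ((c⁻¹ * ((if i = j then 1 else 0) - 1 / n) : ℝ) : ℂ) =
        1 / (4 * c) * (if i = j then a i * a j else 0) - 1 / (4 * c * n) * (a i * a j) := by
      intro i j
      split_ifs
      · push_cast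
        field_simp
      · push_cast
        field_simp
        ring
    rw [Fintype.sum_prod_type]
    simp only [h1, Finset.sum_sub_distrib, ← Finset.mul_sum, ha, Finset.sum_ite_eq,
      Finset.mem_univ, if_true, mul_zero, sub_zero]
    rw [one_div_mul_eq_div]
    simp only [sq]
  have hlin : ∑ i : Fin n, a i * ((-(((n - 1) / 2 - i) / (2 * c)) : ℝ) : ℂ) =
      -((2 * ∑ i : Fin n, a i * (((n - 1) / 2 - i : ℝ) : ℂ)) / (4 * c)) := by
    rw [Finset.mul_sum, Finset.sum_div, ← Finset.sum_neg_distrib]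
    refine Finset.sum_congr rfl fun i _ => ?_
    push_cast
    field_simp
    ring
  rw [hsq, hlin]
  ring

end Laplacian

/-! ### The Fourier kernel in terms of minors. -/

section Kernel

variable {n : ℕ}

/-- The horocycle distance in terms of the lower right minors. -/
theorem IsHorocycleDist.apply_eq {k : Matrix.specialOrthogonalGroup (Fin n) ℝ} {σ : UniMetric n}
    {H : Cartan n} (h : IsHorocycleDist k σ H) (i : Fin n) :
    H.1 i = logMinor i (k.1ᵀ * σ.1 * k.1) := by
  obtain ⟨g, ν, κ, hg, hν, hν1, hk⟩ := h
  set b := ν * Matrix.diagonal (fun i => Real.exp (H.1 i)) with hb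
  have hκ : κ.1 * κ.1ᵀ = 1 := by
    have := (Matrix.mem_orthogonalGroup_iff (Fin n) ℝ).1
      (Matrix.mem_specialOrthogonalGroup_iff.1 κ.2).1
    simpa [Matrix.star_eq_conjTranspose] using this
  have hbb : b * bᵀ = k.1ᵀ * σ.1 * k.1 := by
    have e : (k.1ᵀ * g.1) * (k.1ᵀ * g.1)ᵀ = k.1ᵀ * σ.1 * k.1 := by
      rw [Matrix.transpose_mul, Matrix.transpose_transpose, ← hg]
      simp only [Matrix.mul_assoc]
    rw [← e, hk, Matrix.transpose_mul b, Matrix.mul_assoc b, ← Matrix.mul_assoc κ.1, hκ, one_mul]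
  have hbt : b.BlockTriangular id := hν.mul (Matrix.blockTriangular_diagonal _)
  have hbd : ∀ i, b i i = Real.exp (H.1 i) := fun i => by
    rw [hb, Matrix.mul_diagonal, hν1, one_mul]
  rw [← hbb, logMinor_eq hbt fun i => by rw [hbd]; exact Real.exp_pos _, hbd, Real.log_exp]

/-- The Iwasawa decomposition. -/
theorem exists_isHorocycleDist (k : Matrix.specialOrthogonalGroup (Fin n) ℝ) (σ : UniMetric n) :
    ∃ H, IsHorocycleDist k σ H := by
  have hko : k.1 * k.1ᵀ = 1 := by
    have := (Matrix.mem_orthogonalGroup_iff (Fin n) ℝ).1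
      (Matrix.mem_specialOrthogonalGroup_iff.1 k.2).1
    simpa [Matrix.star_eq_conjTranspose] using this
  have hko' : k.1ᵀ * k.1 = 1 := mul_eq_one_comm.1 hko
  have hkd : k.1.det = 1 := (Matrix.mem_specialOrthogonalGroup_iff.1 k.2).2
  have hku : IsUnit k.1 := by rw [Matrix.isUnit_iff_isUnit_det, hkd]; exact isUnit_one
  obtain ⟨b, hb, hpos, hbb⟩ := exists_upper_cholesky (posDef_congr σ.2.1 hku)
  have hbdet : b.det = 1 := by
    have h1 := congrArg Matrix.det hbb
    rw [Matrix.det_mul, Matrix.det_mul, Matrix.det_mul, Matrix.det_transpose, Matrix.det_transpose,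
      hkd, σ.2.2] at h1
    have h2 : 0 < b.det := by
      rw [Matrix.det_of_isUpperTriangular hb]
      exact Finset.prod_pos fun i _ => hpos i
    nlinarith
  have hsum : ∑ i, Real.log (b i i) = 0 := by
    rw [← Real.log_prod fun i _ => (hpos i).ne', ← Matrix.det_of_isUpperTriangular hb, hbdet,
      Real.log_one]
  -- Any `g` with `ggᵀ = σ` is allowed, and `g = kb` makes `k⁻¹g` upper triangular, so that `κ = 1`
  -- serves.
  refine ⟨⟨WithLp.toLp 2 fun i => Real.log (b i i), hsum⟩,
    ⟨k.1 * b, by rw [Matrix.det_mul, hkd, hbdet, one_mul]⟩,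
    b * Matrix.diagonal (fun i => (b i i)⁻¹), 1, ?_, ?_, fun i => ?_, ?_⟩
  · rw [Matrix.transpose_mul]
    calc k.1 * b * (bᵀ * k.1ᵀ) = k.1 * (b * bᵀ) * k.1ᵀ := by simp only [Matrix.mul_assoc]
      _ = (k.1 * k.1ᵀ) * σ.1 * (k.1 * k.1ᵀ) := by rw [hbb]; simp only [Matrix.mul_assoc]
      _ = σ.1 := by rw [hko, one_mul, mul_one]
  · exact hb.mul (Matrix.blockTriangular_diagonal _)
  · rw [Matrix.mul_diagonal, mul_inv_cancel₀ (hpos i).ne']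
  · have e : ∀ i, Real.exp (Real.log (b i i)) = b i i := fun i => Real.exp_log (hpos i)
    simp only [e]
    rw [Matrix.mul_assoc b, Matrix.diagonal_mul_diagonal]
    have e2 : (fun i => (b i i)⁻¹ * b i i) = fun _ => 1 :=
      funext fun i => inv_mul_cancel₀ (hpos i).ne'
    rw [e2, Matrix.diagonal_one, mul_one, ← Matrix.mul_assoc, hko', one_mul]
    exact (mul_one b).symm

/-- The minors determine every admissible `H`, so the value chosen by `Classical.epsilon` is known
once one exists. -/
theorem horocycleDist_apply (k : Matrix.specialOrthogonalGroup (Fin n) ℝ) (σ : UniMetric n)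
    (i : Fin n) : (horocycleDist k σ).1 i = logMinor i (k.1ᵀ * σ.1 * k.1) :=
  IsHorocycleDist.apply_eq (Classical.epsilon_spec (exists_isHorocycleDist k σ)) i

/-- The vector of `𝔞` dual to a linear form. -/
def dualVec (l : StrongDual ℝ (Cartan n)) : Cartan n :=
  (InnerProductSpace.toDual ℝ (Cartan n)).symm l

theorem apply_eq_sum (l : StrongDual ℝ (Cartan n)) (H : Cartan n) :
    l H = ∑ i, (dualVec l).1 i * H.1 i := by
  have h : inner ℝ (dualVec l) H = l H := InnerProductSpace.toDual_symm_apply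
  rw [← h, Submodule.coe_inner, PiLp.inner_apply]
  exact Finset.sum_congr rfl fun i _ => by simp [mul_comm]

theorem norm_sq_eq_sum (l : StrongDual ℝ (Cartan n)) : ‖l‖ ^ 2 = ∑ i, (dualVec l).1 i ^ 2 := by
  have h : ‖l‖ = ‖dualVec l‖ := (LinearIsometryEquiv.norm_map _ l).symm
  rw [h, Submodule.coe_norm, EuclideanSpace.norm_sq_eq]
  simp

theorem sum_dualVec (l : StrongDual ℝ (Cartan n)) : ∑ i, (dualVec l).1 i = 0 := (dualVec l).2

theorem sum_half_sub : ∑ i : Fin n, (((n : ℝ) - 1) / 2 - (i : ℕ)) = 0 := by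
  rw [Finset.sum_sub_distrib, Fin.sum_univ_eq_sum_range (fun i => (i : ℝ)), Finset.sum_const,
    Finset.card_univ, Fintype.card_fin, nsmul_eq_mul]
  rcases n with _ | n
  · simp
  · have h := Finset.sum_range_id_mul_two (n + 1)
    rw [Nat.add_sub_cancel] at h
    have h2 : (∑ i ∈ Finset.range (n + 1), (i : ℝ)) * 2 = (n + 1) * n := by
      have h3 := congrArg (Nat.cast : ℕ → ℝ) h
      push_cast at h3
      exact h3
    push_cast
    linarith

/-- The coordinate `H_i` occurs `n - 1 - i` times with a plus sign and `i` times with a minus sign.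
-/
theorem rho_apply (H : Cartan n) :
    rho n H = ∑ i : Fin n, (((n : ℝ) - 1) / 2 - (i : ℕ)) * H.1 i := by
  have h1 : rho n H = 1 / 2 * ∑ i : Fin n, ∑ j ∈ Finset.Ioi i, (H.1 i - H.1 j) := by
    simp [rho, _root_.sum_apply]
  have h2 : ∑ i : Fin n, ∑ j ∈ Finset.Ioi i, (H.1 i - H.1 j) =
      ∑ i : Fin n, ((n : ℝ) - 1 - i) * H.1 i - ∑ j : Fin n, (j : ℝ) * H.1 j := by
    simp only [Finset.sum_sub_distrib, Finset.sum_const, nsmul_eq_mul]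
    congr 1
    · refine Finset.sum_congr rfl fun i _ => ?_
      rw [Fin.card_Ioi, Nat.sub_sub, Nat.cast_sub (by omega)]
      push_cast
      ring
    · rw [Finset.sum_comm' (t' := Finset.univ) (s' := fun j => Finset.Iio j) (by simp)]
      simp
  rw [h1, h2, ← Finset.sum_sub_distrib, Finset.mul_sum]
  exact Finset.sum_congr rfl fun i _ => by ring

/-- The coefficients of `ρ` already sum to zero, so they form a vector of `𝔞` and no projection
intervenes. -/
theorem dualVec_rho (i : Fin n) : (dualVec (rho n)).1 i = ((n : ℝ) - 1) / 2 - (i : ℕ) := by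
  have h : dualVec (rho n) = ⟨WithLp.toLp 2 fun i : Fin n => ((n : ℝ) - 1) / 2 - (i : ℕ),
      sum_half_sub⟩ := by
    refine (LinearIsometryEquiv.symm_apply_eq _).2 ?_
    ext H
    rw [rho_apply, InnerProductSpace.toDual_apply_apply, Submodule.coe_inner, PiLp.inner_apply]
    exact Finset.sum_congr rfl fun i _ => by simp [mul_comm]
  rw [h]

/-- The exponents of `e_{λ,b}` as a function of the minors. -/
def kernelExponent (l : StrongDual ℝ (Cartan n)) (i : Fin n) : ℂ :=
  Complex.I * ((dualVec l).1 i : ℂ) + ((((n : ℝ) - 1) / 2 - (i : ℕ) : ℝ) : ℂ)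

theorem fourierKernel_eq (l : StrongDual ℝ (Cartan n))
    (k : Matrix.specialOrthogonalGroup (Fin n) ℝ) (σ : UniMetric n) :
    fourierKernel l k σ =
      Complex.exp (∑ i, kernelExponent l i * (logMinor i (k.1ᵀ * σ.1 * k.1) : ℂ)) := by
  rw [fourierKernel, apply_eq_sum l, rho_apply]
  congr 1
  simp only [horocycleDist_apply, kernelExponent]
  push_cast
  rw [Finset.mul_sum, ← Finset.sum_add_distrib]
  exact Finset.sum_congr rfl fun i _ => by ring

theorem sum_kernelExponent (l : StrongDual ℝ (Cartan n)) : ∑ i, kernelExponent l i = 0 := by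
  simp only [kernelExponent]
  rw [Finset.sum_add_distrib, ← Finset.mul_sum, ← Complex.ofReal_sum, ← Complex.ofReal_sum,
    sum_dualVec, sum_half_sub]
  simp

/-- Completing the square: `a² - 2aρ = (a - ρ)² - ρ²`, and `a - ρ = iλ` in each coordinate. -/
theorem kernelExponent_eigenvalue (c : ℝ) (l : StrongDual ℝ (Cartan n)) :
    (∑ i, kernelExponent l i ^ 2 - 2 * ∑ i : Fin n, kernelExponent l i *
      (((n - 1) / 2 - i : ℝ) : ℂ)) / (4 * c) =
      -((dualNormSq c l + dualNormSq c (rho n) : ℝ) : ℂ) := by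
  rw [dualNormSq, dualNormSq, norm_sq_eq_sum, norm_sq_eq_sum, ← add_div, ← Finset.sum_add_distrib]
  simp only [dualVec_rho]
  rw [Finset.mul_sum, ← Finset.sum_sub_distrib]
  push_cast
  rw [← neg_div, ← Finset.sum_neg_distrib]
  congr 1
  refine Finset.sum_congr rfl fun i _ => ?_
  simp only [kernelExponent]
  push_cast
  linear_combination ((dualVec l).1 i : ℂ) ^ 2 * Complex.I_sq

end Kernel

/-! ### The eigenvalue equation on `M` and the normalization. -/

section Eigenfunction

variable {n : ℕ} {ψ : (Fin (dim n) → ℝ) → UniMetric n} {U : Set (Fin (dim n) → ℝ)}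

theorem IsParam.contDiffAt (hψ : IsParam ψ U) {u : Fin (dim n) → ℝ} (hu : u ∈ U) :
    ContDiffAt ℝ ∞ (fun w => (ψ w).1) u :=
  contDiffAt_matrix fun i j => (hψ.smooth i j).contDiffAt (hψ.isOpen.mem_nhds hu)

theorem IsParam.coordVec_eq (hψ : IsParam ψ U) {u : Fin (dim n) → ℝ} (hu : u ∈ U)
    (A : Fin (dim n)) : coordVec ψ u A = pd A (fun w => (ψ w).1) u := by
  ext i j
  exact pd_entry ((hψ.contDiffAt hu).differentiableAt (by simp)) i j

theorem IsParam.coordMetric_eq (hψ : IsParam ψ U) (c : ℝ) {u : Fin (dim n) → ℝ} (hu : u ∈ U) :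
    coordMetric c ψ u = traceGram c fun E => logPd (fun w => (ψ w).1) E u := by
  ext A B
  simp only [coordMetric, metric, traceGram, Matrix.of_apply, hψ.coordVec_eq hu, logPd,
    Matrix.mul_assoc]

/-- Exponentials of linear combinations of `logMinor` are eigenfunctions. -/
theorem isEigenfunction_cexp_logMinor (hn : 0 < n) {c : ℝ} (hc : 0 < c)
    {k : Matrix (Fin n) (Fin n) ℝ} (hk : IsUnit k) (l : StrongDual ℝ (Cartan n)) :
    IsEigenfunction c
      (fun σ => Complex.exp (∑ i, kernelExponent l i * (logMinor i (kᵀ * σ.1 * k) : ℂ)))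
      (dualNormSq c l + dualNormSq c (rho n)) where
  smooth := fun ψ U hψ u hu => by
    refine ContDiffAt.contDiffWithinAt ?_
    refine ContDiffAt.cexp (ContDiffAt.sum fun i _ => contDiffAt_const.mul ?_)
    exact Complex.ofRealCLM.contDiff.contDiffAt.comp u
      (contDiffAt_logMinor i (hψ.contDiffAt hu) (ψ u).2.1 hk)
  ne_zero := fun h => by
    have hone : (1 : Matrix (Fin n) (Fin n) ℝ).PosDef ∧ (1 : Matrix (Fin n) (Fin n) ℝ).det = 1 :=
      ⟨Matrix.PosDef.one, Matrix.det_one⟩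
    exact Complex.exp_ne_zero _ (congrFun h ⟨1, hone⟩)
  eigen := fun ψ U hψ u hu => by
    have hev : ∀ᶠ w in nhds u, w ∈ U := hψ.isOpen.mem_nhds hu
    rw [laplace_congr (hev.mono fun w hw => hψ.coordMetric_eq c hw)]
    have himm := hψ.immersion u hu
    rw [funext (hψ.coordVec_eq hu)] at himm
    refine (laplace_cexp_logMinor hn hc (hev.mono fun w hw => hψ.contDiffAt hw)
      (fun w => (ψ w).2.1) (fun w => (ψ w).2.2) himm hk _ (sum_kernelExponent l)).trans ?_
    rw [kernelExponent_eigenvalue, neg_mul]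

/-- The action is absorbed into `k`: `kᵀ(gσgᵀ)k = (gᵀk)ᵀσ(gᵀk)`. The new matrix is invertible but in
general not orthogonal, hence the generality in `isEigenfunction_cexp_logMinor`. -/
theorem fourierKernel_comp_act (l : StrongDual ℝ (Cartan n))
    (k : Matrix.specialOrthogonalGroup (Fin n) ℝ) (g : Matrix.SpecialLinearGroup (Fin n) ℝ) :
    fourierKernel l k ∘ act g = fun σ => Complex.exp (∑ i, kernelExponent l i *
      (logMinor i ((g.1ᵀ * k.1)ᵀ * σ.1 * (g.1ᵀ * k.1)) : ℂ)) := by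
  funext σ
  rw [Function.comp_apply, fourierKernel_eq]
  simp only [act, Matrix.transpose_mul, Matrix.transpose_transpose, Matrix.mul_assoc]

theorem isUnit_specialOrthogonal (k : Matrix.specialOrthogonalGroup (Fin n) ℝ) : IsUnit k.1 := by
  rw [Matrix.isUnit_iff_isUnit_det, (Matrix.mem_specialOrthogonalGroup_iff.1 k.2).2]
  exact isUnit_one

open scoped MatrixOrder in
theorem act_sqrtInv_self (σ : UniMetric n) : (act (sqrtInv σ) σ).1 = 1 := by
  have hunit : IsUnit σ.1.det := by rw [σ.2.2]; exact isUnit_one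
  set s : Matrix (Fin n) (Fin n) ℝ := (sqrtInv σ).1 with hs
  have hss : s * s = σ.1⁻¹ := CFC.sqrt_mul_sqrt_self _ σ.2.1.inv.posSemidef.nonneg
  have hst : sᵀ = s := by
    have h : s.IsHermitian := (Matrix.nonneg_iff_posSemidef.mp (CFC.sqrt_nonneg (σ.1⁻¹))).1
    rw [← Matrix.conjTranspose_eq_transpose_of_trivial]
    exact h
  have h1 : (s * σ.1) * s = 1 := by
    rw [mul_eq_one_comm, ← Matrix.mul_assoc, hss, Matrix.nonsing_inv_mul _ hunit]
  change s * σ.1 * sᵀ = 1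
  rw [hst, h1]

theorem fourierKernel_of_eq_one (l : StrongDual ℝ (Cartan n))
    (k : Matrix.specialOrthogonalGroup (Fin n) ℝ) {σ : UniMetric n} (hσ : σ.1 = 1) :
    fourierKernel l k σ = 1 := by
  have hko : k.1ᵀ * k.1 = 1 := by
    have := (Matrix.mem_orthogonalGroup_iff' (Fin n) ℝ).1
      (Matrix.mem_specialOrthogonalGroup_iff.1 k.2).1
    simpa [Matrix.star_eq_conjTranspose] using this
  rw [fourierKernel_eq, hσ, mul_one, hko]
  simp [logMinor, tailBlock_one]

end Eigenfunction

end UniMetric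

end

theorem theorem3p3 {n : ℕ} (hn : 2 ≤ n)
    {S₀ : Type*} [TopologicalSpace S₀] [ChartedSpace (EuclideanSpace ℝ (Fin n)) S₀]
    [IsManifold (𝓡 n) 1 S₀]
    (χ : Bundle.ContinuousRiemannianMetric (EuclideanSpace ℝ (Fin n))
      (fun x : S₀ => TangentSpace (𝓡 n) x))
    (c : ℝ) (hc : 0 < c)
    (l : StrongDual ℝ (UniMetric.Cartan n)) (b₀ : Matrix.specialOrthogonalGroup (Fin n) ℝ) :
    UniMetric.IsEigenfunction c (UniMetric.fourierKernel l b₀)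
        (UniMetric.dualNormSq c l + UniMetric.dualNormSq c (UniMetric.rho n)) ∧
      ∀ φ ∈ IsManifold.maximalAtlas (𝓡 n) 1 S₀, ∀ hφ : RiemChart.IsUnimodular χ φ,
        ∀ (x : S₀) (hx : x ∈ φ.source),
          UniMetric.IsEigenfunction c
            (UniMetric.fourierKernel l b₀ ∘
              UniMetric.act (UniMetric.sqrtInv (RiemChart.metricAt χ φ hφ x hx)))
            (UniMetric.dualNormSq c l + UniMetric.dualNormSq c (UniMetric.rho n)) ∧
          (UniMetric.fourierKernel l b₀ ∘
              UniMetric.act (UniMetric.sqrtInv (RiemChart.metricAt χ φ hφ x hx)))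
            (RiemChart.metricAt χ φ hφ x hx) = 1 := by
  have hn0 : 0 < n := by omega
  refine ⟨?_, fun φ _ hφ x hx => ⟨?_, ?_⟩⟩
  · rw [funext (UniMetric.fourierKernel_eq l b₀)]
    exact UniMetric.isEigenfunction_cexp_logMinor hn0 hc (UniMetric.isUnit_specialOrthogonal b₀) l
  · rw [UniMetric.fourierKernel_comp_act]
    refine UniMetric.isEigenfunction_cexp_logMinor hn0 hc ?_ l
    rw [Matrix.isUnit_iff_isUnit_det, Matrix.det_mul, Matrix.det_transpose,
      Matrix.SpecialLinearGroup.det_coe, one_mul, ← Matrix.isUnit_iff_isUnit_det]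
    exact UniMetric.isUnit_specialOrthogonal b₀
  · exact UniMetric.fourierKernel_of_eq_one l b₀ (UniMetric.act_sqrtInv_self _)
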